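/- Fix an integer $N\ge 1$. Let $\mathbb{C}P^N$ carry the Fubini--Study metric, normalized so that a holomorphic curve $f=[f_0:\dots:f_N]\colon\mathbb{C}\to\mathbb{C}P^N$ (with $f_i$ holomorphic without common zeros) has local Lipschitz constant $|df|(z)\ge 0$ given by \[ |df|^2(z)=\frac{1}{4\pi}\left(\frac{\partial^2}{\partial x^2}+\frac{\partial^2}{\partial y^2}\right)\log\left(|f_0(z)|^2+\dots+|f_N(z)|^2\right),\qquad z=x+y\sqrt{-1}, \] and let $d_{\mathrm{FS}}$ be the induced distance function, that is $d_{\mathrm{FS}}([x],[y])=\frac{1}{\sqrt{\pi}}\arccos\frac{|\langle x,y\rangle|}{\|x\|\,\|y\|}$. For $\lambda>0$ let $\mathcal{B}^N_\lambda$ be the set of holomorphic maps $f\colon\mathbb{C}\to\mathbb{C}P^N$ with $|df|(z)\le\lambda$ for all $z\in\mathbb{C}$, and let $\mathcal{B}^N=\mathcal{B}^N_1$ (the Brody curves). Put $\mathbf{d}_{\mathbb{C}}(f,g)=\sup_{z\in\mathbb{C}}d_{\mathrm{FS}}(f(z),g(z))$ and, for $f\in\mathcal{B}^N$ and $r>0$,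 $B_r(f,\mathbf{d}_{\mathbb{C}})=\{g\in\mathcal{B}^N\mid \mathbf{d}_{\mathbb{C}}(f,g)\le r\}$. For $R>0$, a holomorphic map $f\colon\mathbb{C}\to\mathbb{C}P^N$ is called $R$-nondegenerate if $\max_{|z-a|\le R}|df|(z)\ge 1/R$ for every $a\in\mathbb{C}$. There exist constants $\delta_2>0$ and $C_3>1$, and for every $\eta>0$ a constant $R_1=R_1(\eta)>0$ (so $\delta_2$ and $C_3$ do not depend on $\eta$), such that for every Brody curve $f\in\mathcal{B}^N$ there exists a map $\Phi\colon B_{\delta_2}(f,\mathbf{d}_{\mathbb{C}})\to\mathcal{B}^N_{1+\eta}$ satisfying the following three conditions. \begin{enumerate} \item $\Phi(f)$ is $R_1$-nondegenerate. \item For any $g_1,g_2\in B_{\delta_2}(f,\mathbf{d}_{\mathbb{C}})$ and $z\in\mathbb{C}$ we have \[ d_{\mathrm{FS}}\left(\Phi(g_1)(z),\Phi(g_2)(z)\right)\le C_3\,d_{\mathrm{FS}}\left(g_1(z),g_2(z)\right), \] \[ d_{\mathrm{FS}}\left(g_1(z),g_2(z)\right)\le C_3\sup_{|w-z|\le 3}d_{\mathrm{FS}}\left(\Phi(g_1)(w),\Phi(g_2)(w)\right).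 \] In particular, the image of $\Phi$ is contained in $\{g\in\mathcal{B}^N_{1+\eta}\mid \mathbf{d}_{\mathbb{C}}(\Phi(f),g)\le C_3\delta_2\}$. \item For any square $S\subset\mathbb{C}$ (with sides in arbitrary directions) of side length $L\ge R_1$, \[ \left|\int_S|df|^2\,dxdy-\int_S|d\Phi(f)|^2\,dxdy\right|<\eta L^2. \] \end{enumerate} -/

import Mathlib

open Filter Topology MeasureTheory

noncomputable section

namespace Brody

/-- The Hermitian space `ℂ^(N+1)` of homogeneous coordinates. -/
abbrev HomCoord (N : ℕ) : Type := EuclideanSpace ℂ (Fin (N + 1))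

/-- The complex projective space `ℂP^N`. -/
abbrev CP (N : ℕ) : Type := Projectivization ℂ (HomCoord N)

/-! ### The Fubini–Study metric, normalised so that a projective line has area one -/

/-- The component of `v` orthogonal to the complex line through `x`. -/
def orthPart {N : ℕ} (x v : HomCoord N) : HomCoord N :=
  v - (inner ℂ x v / (‖x‖ : ℂ) ^ 2) • x

/-- The Fubini–Study length of the tangent vector of `ℂP^N` at `[x]` that is the image of
`v ∈ T_x ℂ^(N+1) = ℂ^(N+1)` under the differential of the projection `x ↦ [x]`. -/
def fsNorm {N : ℕ} (x v : HomCoord N) : ℝ :=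
  ‖orthPart x v‖ / (Real.sqrt Real.pi * ‖x‖)

/-- The Fubini–Study distance between `[x]` and `[y]`, in homogeneous coordinates. -/
def fsDistCoord {N : ℕ} (x y : HomCoord N) : ℝ :=
  Real.arccos (‖(inner ℂ x y : ℂ)‖ / (‖x‖ * ‖y‖)) / Real.sqrt Real.pi

/-- The Fubini–Study distance function on `ℂP^N`. -/
def dFS {N : ℕ} (p q : CP N) : ℝ := fsDistCoord p.rep q.rep

theorem fsDistCoord_smul {N : ℕ} (x y : HomCoord N) (a b : ℂ) (ha : a ≠ 0) (hb : b ≠ 0) :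
    fsDistCoord (a • x) (b • y) = fsDistCoord x y := by
  unfold fsDistCoord
  have ha' : ‖a‖ ≠ 0 := norm_ne_zero_iff.2 ha
  have hb' : ‖b‖ ≠ 0 := norm_ne_zero_iff.2 hb
  congr 2
  rw [inner_smul_left, inner_smul_right, norm_mul, norm_mul, norm_smul, norm_smul,
    RCLike.norm_conj]
  rw [show ‖a‖ * (‖b‖ * ‖(inner ℂ x y : ℂ)‖) = (‖a‖ * ‖b‖) * ‖(inner ℂ x y : ℂ)‖ by ring,
    show ‖a‖ * ‖x‖ * (‖b‖ * ‖y‖) = (‖a‖ * ‖b‖) * (‖x‖ * ‖y‖) by ring,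
    mul_div_mul_left _ _ (mul_ne_zero ha' hb')]

/-- The distance does not depend on the choice of homogeneous coordinates. -/
theorem dFS_mk {N : ℕ} (x y : HomCoord N) (hx : x ≠ 0) (hy : y ≠ 0) :
    dFS (Projectivization.mk ℂ x hx) (Projectivization.mk ℂ y hy) = fsDistCoord x y := by
  obtain ⟨a, ha⟩ := Projectivization.exists_smul_eq_mk_rep ℂ x hx
  obtain ⟨b, hb⟩ := Projectivization.exists_smul_eq_mk_rep ℂ y hy
  unfold dFS
  rw [← ha, ← hb]
  exact fsDistCoord_smul x y a b a.ne_zero b.ne_zero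

theorem dFS_self {N : ℕ} (p : CP N) : dFS p p = 0 := by
  have h : ‖p.rep‖ ≠ 0 := norm_ne_zero_iff.2 p.rep_nonzero
  unfold dFS fsDistCoord
  rw [inner_self_eq_norm_sq_to_K]
  have : ‖(((‖p.rep‖ : ℝ) : ℂ)) ^ 2‖ / (‖p.rep‖ * ‖p.rep‖) = 1 := by
    rw [norm_pow, Complex.norm_real, norm_norm]
    field_simp
  erw [this]
  simp

/-! ### Holomorphic curves and their local Lipschitz constant -/

/-- `F` is a holomorphic lift of `f : ℂ → ℂP^N` to homogeneous coordinates near `z`. -/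
def IsLiftAt {N : ℕ} (f : ℂ → CP N) (z : ℂ) (F : ℂ → HomCoord N) : Prop :=
  AnalyticAt ℂ F z ∧ ∀ᶠ w in 𝓝 z, ∃ h : F w ≠ 0, f w = Projectivization.mk ℂ (F w) h

/-- `f : ℂ → ℂP^N` is holomorphic: near every point it is given by
`[f_0(z) : ⋯ : f_N(z)]` with holomorphic functions `f_i` that have no common zero. -/
def IsHolomorphicCurve {N : ℕ} (f : ℂ → CP N) : Prop :=
  ∀ z : ℂ, ∃ F : ℂ → HomCoord N, IsLiftAt f z F

open Classical in
/-- The local Lipschitz constant `|df|(z)`: the Fubini–Study length of `df(v)` for a unit tangent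
vector `v` at `z`. It is computed with a holomorphic lift near `z`, whose choice does not matter
by `speed_eq` (the value `0` is used where there is no such lift). -/
def speed {N : ℕ} (f : ℂ → CP N) (z : ℂ) : ℝ :=
  if h : ∃ F : ℂ → HomCoord N, IsLiftAt f z F then fsNorm (h.choose z) (deriv h.choose z) else 0

theorem orthPart_self {N : ℕ} (x : HomCoord N) : orthPart x x = 0 := by
  unfold orthPart
  rcases eq_or_ne x 0 with rfl | hx
  · simp
  · have h : ((‖x‖ : ℝ) : ℂ) ≠ 0 := by simpa using hx
    rw [inner_self_eq_norm_sq_to_K]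
    erw [div_self (pow_ne_zero 2 h)]
    simp

theorem orthPart_add {N : ℕ} (x v w : HomCoord N) :
    orthPart x (v + w) = orthPart x v + orthPart x w := by
  unfold orthPart
  rw [inner_add_right, add_div, add_smul]
  abel

theorem orthPart_smul {N : ℕ} (x v : HomCoord N) (c : ℂ) :
    orthPart x (c • v) = c • orthPart x v := by
  unfold orthPart
  rw [inner_smul_right, smul_sub, smul_smul, mul_div_assoc]

theorem orthPart_smul_left {N : ℕ} (x v : HomCoord N) (c : ℂ) (hc : c ≠ 0) :
    orthPart (c • x) v = orthPart x v := by
  unfold orthPart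
  rcases eq_or_ne x 0 with rfl | hx
  · simp
  have h : ((‖x‖ : ℝ) : ℂ) ≠ 0 := by simpa using hx
  have h2 : (starRingEnd ℂ) c ≠ 0 := by simpa using hc
  rw [inner_smul_left, norm_smul, smul_smul]
  congr 2
  push_cast
  rw [mul_pow, ← Complex.mul_conj']
  field_simp

/-- The Fubini–Study length is that of a tangent vector of `ℂP^N`: replacing a lift `F` by `c F`
does not change it. -/
theorem fsNorm_change {N : ℕ} (x v : HomCoord N) (c d : ℂ) (hc : c ≠ 0) :
    fsNorm (c • x) (c • v + d • x) = fsNorm x v := by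
  unfold fsNorm
  have hc' : ‖c‖ ≠ 0 := norm_ne_zero_iff.2 hc
  rw [orthPart_smul_left _ _ _ hc, orthPart_add, orthPart_smul, orthPart_smul, orthPart_self,
    smul_zero, add_zero, norm_smul, norm_smul,
    show Real.sqrt Real.pi * (‖c‖ * ‖x‖) = ‖c‖ * (Real.sqrt Real.pi * ‖x‖) by ring,
    mul_div_mul_left _ _ hc']

theorem IsLiftAt.fsNorm_eq {N : ℕ} {f : ℂ → CP N} {z : ℂ} {F G : ℂ → HomCoord N}
    (hF : IsLiftAt f z F) (hG : IsLiftAt f z G) :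
    fsNorm (G z) (deriv G z) = fsNorm (F z) (deriv F z) := by
  have hFz : F z ≠ 0 := hF.2.self_of_nhds.1
  let ℓ : HomCoord N →L[ℂ] ℂ := innerSL ℂ (F z)
  have hℓF : AnalyticAt ℂ (fun w => ℓ (F w)) z := (ℓ.analyticAt _).comp hF.1
  have hℓG : AnalyticAt ℂ (fun w => ℓ (G w)) z := (ℓ.analyticAt _).comp hG.1
  have hℓz : ℓ (F z) ≠ 0 := by
    change inner ℂ (F z) (F z) ≠ 0
    exact inner_self_ne_zero.2 hFz
  have hne : ∀ᶠ w in 𝓝 z, ℓ (F w) ≠ 0 := hℓF.continuousAt.eventually_ne hℓz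
  let c : ℂ → ℂ := fun w => ℓ (G w) / ℓ (F w)
  have hc : AnalyticAt ℂ c z := hℓG.div hℓF hℓz
  have hmain : ∀ᶠ w in 𝓝 z, G w = c w • F w ∧ c w ≠ 0 := by
    filter_upwards [hF.2, hG.2, hne] with w hw1 hw2 hw3
    obtain ⟨h1, e1⟩ := hw1
    obtain ⟨h2, e2⟩ := hw2
    obtain ⟨a, ha⟩ := (Projectivization.mk_eq_mk_iff' ℂ _ _ h2 h1).1 (e2.symm.trans e1)
    have hca : c w = a := by
      change ℓ (G w) / ℓ (F w) = a
      rw [← ha, map_smul, smul_eq_mul, mul_div_assoc, div_self hw3, mul_one]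
    refine ⟨by rw [hca, ha], ?_⟩
    rw [hca]
    rintro rfl
    exact h2 (by rw [← ha, zero_smul])
  have hev : G =ᶠ[𝓝 z] fun w => c w • F w := hmain.mono fun w hw => hw.1
  have hd : deriv G z = c z • deriv F z + deriv c z • F z := by
    rw [hev.deriv_eq]
    exact deriv_fun_smul hc.differentiableAt hF.1.differentiableAt
  rw [hd, hmain.self_of_nhds.1]
  exact fsNorm_change _ _ _ _ hmain.self_of_nhds.2

theorem speed_eq {N : ℕ} {f : ℂ → CP N} {z : ℂ} {F : ℂ → HomCoord N} (hF : IsLiftAt f z F) :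
    speed f z = fsNorm (F z) (deriv F z) := by
  have h : ∃ F : ℂ → HomCoord N, IsLiftAt f z F := ⟨F, hF⟩
  unfold speed
  rw [dif_pos h]
  exact hF.fsNorm_eq h.choose_spec

theorem norm_orthPart_sq {N : ℕ} (x v : HomCoord N) (hx : x ≠ 0) :
    ‖orthPart x v‖ ^ 2 = ‖v‖ ^ 2 - ‖(inner ℂ x v : ℂ)‖ ^ 2 / ‖x‖ ^ 2 := by
  have h : ‖x‖ ≠ 0 := norm_ne_zero_iff.2 hx
  unfold orthPart
  rw [@norm_sub_sq ℂ, inner_smul_right, norm_smul]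
  have e : inner ℂ x v / (‖x‖ : ℂ) ^ 2 * inner ℂ v x
      = (((‖(inner ℂ x v : ℂ)‖ ^ 2 / ‖x‖ ^ 2 : ℝ)) : ℂ) := by
    rw [div_mul_eq_mul_div, ← inner_conj_symm v x, Complex.mul_conj']
    push_cast; rfl
  rw [e, norm_div, norm_pow, Complex.norm_real, norm_norm]
  change ‖v‖ ^ 2 - 2 * (((‖(inner ℂ x v : ℂ)‖ ^ 2 / ‖x‖ ^ 2 : ℝ) : ℂ)).re + _ = _
  rw [Complex.ofReal_re]
  field_simp
  ring

theorem fsDistCoord_eq_arcsin {N : ℕ} (x y : HomCoord N) (hx : x ≠ 0) (hy : y ≠ 0) :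
    fsDistCoord x y = Real.arcsin (‖orthPart x y‖ / ‖y‖) / Real.sqrt Real.pi := by
  have h : ‖x‖ ≠ 0 := norm_ne_zero_iff.2 hx
  have h' : ‖y‖ ≠ 0 := norm_ne_zero_iff.2 hy
  unfold fsDistCoord
  rw [Real.arccos_eq_arcsin (by positivity)]
  congr 2
  rw [← Real.sqrt_sq (by positivity : 0 ≤ ‖orthPart x y‖ / ‖y‖), div_pow ‖orthPart x y‖, norm_orthPart_sq x y hx]
  congr 1
  field_simp
/-- `speed f z` is the local Lipschitz constant of `f` at `z` for the distance `dFS`. -/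
theorem tendsto_speed {N : ℕ} {f : ℂ → CP N} (hf : IsHolomorphicCurve f) (z : ℂ) :
    Tendsto (fun w => dFS (f z) (f w) / ‖w - z‖) (𝓝[≠] z) (𝓝 (speed f z)) := by
  obtain ⟨F, hF⟩ := hf z
  rw [speed_eq hF]
  obtain ⟨hz, ez⟩ := hF.2.self_of_nhds
  have hFd := hF.1.differentiableAt.hasDerivAt
  have hsl : Tendsto (fun w => ‖orthPart (F z) (F w)‖ / ‖w - z‖) (𝓝[≠] z)
      (𝓝 ‖orthPart (F z) (deriv F z)‖) := by
    have hc : Continuous (orthPart (F z)) := by unfold orthPart; fun_prop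
    have := ((hc.tendsto _).comp (hasDerivAt_iff_tendsto_slope.1 hFd)).norm
    refine this.congr fun w => ?_
    have h0 : orthPart (F z) (F w - F z) = orthPart (F z) (F w) := by
      rw [sub_eq_add_neg, orthPart_add, ← neg_one_smul ℂ (F z), orthPart_smul, orthPart_self]; simp
    simp only [Function.comp, slope_def_module, orthPart_smul, h0, norm_smul, norm_inv]
    rw [div_eq_inv_mul]
  have hnF : Tendsto (fun w => ‖F w‖) (𝓝[≠] z) (𝓝 ‖F z‖) :=
    (hF.1.continuousAt.norm.tendsto).mono_left nhdsWithin_le_nhds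
  have hnz : ‖F z‖ ≠ 0 := norm_ne_zero_iff.2 hz
  have ht : Tendsto (fun w => ‖orthPart (F z) (F w)‖ / ‖F w‖) (𝓝[≠] z) (𝓝 0) := by
    have hc : Continuous (orthPart (F z)) := by unfold orthPart; fun_prop
    have h1 := ((hc.continuousAt.comp hF.1.continuousAt).norm.tendsto).mono_left
      (nhdsWithin_le_nhds (s := {z}ᶜ))
    have := h1.div hnF hnz
    have h2 : ‖orthPart (F z) (F z)‖ / ‖F z‖ = 0 := by simp [orthPart_self]
    exact h2 ▸ this
  have has : Tendsto (dslope Real.arcsin 0) (𝓝 0) (𝓝 1) := by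
    have hd : HasDerivAt Real.arcsin 1 0 := by
      simpa using Real.hasDerivAt_arcsin (x := 0) (by norm_num) (by norm_num)
    have := (continuousAt_dslope_same.2 hd.differentiableAt).tendsto
    rwa [dslope_same, hd.deriv] at this
  have hfin := ((has.comp ht).mul (hsl.div hnF hnz)).div_const (Real.sqrt Real.pi)
  have e : 1 * (‖orthPart (F z) (deriv F z)‖ / ‖F z‖) / Real.sqrt Real.pi
      = fsNorm (F z) (deriv F z) := by unfold fsNorm; rw [one_mul, div_div, mul_comm]
  rw [e] at hfin
  refine hfin.congr' ?_
  filter_upwards [nhdsWithin_le_nhds hF.2] with w hw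
  obtain ⟨hw, ew⟩ := hw
  rw [ez, ew, dFS_mk, fsDistCoord_eq_arcsin _ _ hz hw]
  have key : ∀ t : ℝ, Real.arcsin t = dslope Real.arcsin 0 t * t := by
    intro t
    have := sub_smul_dslope Real.arcsin 0 t
    simp at this
    rw [← this, mul_comm]
  rw [key]
  simp only [Function.comp, Pi.div_apply]
  field_simp

/-- `f` is `R`-nondegenerate: every closed disk of radius `R` contains a point
where `|df| ≥ 1/R`. -/
def IsNondegenerate {N : ℕ} (R : ℝ) (f : ℂ → CP N) : Prop :=
  ∀ a : ℂ, ∃ z : ℂ, ‖z - a‖ ≤ R ∧ 1 / R ≤ speed f z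

/-- The space of holomorphic curves `f : ℂ → ℂP^N` with `|df| ≤ r` everywhere. -/
def LipCurves (N : ℕ) (r : ℝ) : Set (ℂ → CP N) :=
  {f | IsHolomorphicCurve f ∧ ∀ z : ℂ, speed f z ≤ r}

/-- The space of Brody curves in `ℂP^N`. -/
abbrev BrodyCurves (N : ℕ) : Set (ℂ → CP N) := LipCurves N 1

/-- The uniform distance `sup_z d_FS(f(z), g(z))` over the whole plane. -/
def dC {N : ℕ} (f g : ℂ → CP N) : ℝ := ⨆ z : ℂ, dFS (f z) (g z)

/-- The closed ball, in the space of Brody curves, for the uniform distance. -/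
def brodyBall {N : ℕ} (r : ℝ) (f : ℂ → CP N) : Set (ℂ → CP N) :=
  {g | g ∈ BrodyCurves N ∧ dC f g ≤ r}

theorem mem_brodyBall_self {N : ℕ} {r : ℝ} (hr : 0 < r) {f : ℂ → CP N}
    (hf : f ∈ BrodyCurves N) : f ∈ brodyBall r f := by
  refine ⟨hf, ?_⟩
  unfold dC
  simp only [dFS_self, ciSup_const]
  exact hr.le

/-- The square of side length `L` with corner `a` and with sides in the directions of the unit
complex numbers `u` and `u i`. -/
def square (a u : ℂ) (L : ℝ) : Set ℂ :=
  {z | ∃ x ∈ Set.Icc (0 : ℝ) L, ∃ y ∈ Set.Icc (0 : ℝ) L, z = a + u * (x + y * Complex.I)}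

end Brody

end

/-! The curve `f` is made nondegenerate by inserting one rational bubble in each large region where
it is nearly constant, with a linear operator that depends on `f` only and is then applied to every
`g` near `f`.

Call a disk of radius `R` slow if `speed f < 1 / (20 * R)` on it. The poles are a maximal
`R`-separated set of centres of slow disks. At a pole `b` let `v b` be a unit vector over `f b` and
`u b` a unit vector orthogonal to it. Put `A(w) = 1 + ∑ 8000 (w - b)⁻³ ⟨v b, ·⟩ u b`, and let `Φ(g)`
be the class of `A(w) g(w)`. The cubic decay makes the sum over a separated set in the plane
converge, with size `C / R ^ 3` far from all poles. There `A` is almost the identity and the speed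
hardly changes (`speed_deform_outer`).

Within `R / 2` of a pole `a`, every admissible `g` has a lift `F` near `v a` with `⟨v a, F⟩ = 1`.
Multiplication by `(w - a)³` turns `A F` into the holomorphic, nowhere zero lift `(w - a)³ (F + E F)
+ 8000 u a` (`innerLift`), where `E` collects the other poles. This is a perturbation of `[(w - a)³
v a + 20³ u a]`, wide enough to have speed below one (`speed_deform_inner_le_one`), yet it travels
from `[u a]` almost to `[v a]` within distance 40 (`exists_speed_deform_ge`). By maximality, every
disk of radius `R` has its centre within `R` of a pole or contains a point where `f` was already
fast. This gives nondegeneracy.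

One operator serves all `g`, so the distances of `Φ(g₁)`, `Φ(g₂)` and of `g₁`, `g₂` are compared by
linear algebra (`sinDistCP_deform_le`). For the reverse bound `A` degenerates within distance one of
a pole, where the maximum principle for the difference of normalised lifts is used instead
(`exists_sinDistCP_le_deform`). The energy changes noticeably only on disks of fixed radius `ρ`
about the poles, and these have density of order `ρ² / R²` (`energy_deform_lt`). -/

namespace Brody

variable {N : ℕ}

/-! ### The sine of the angle between two complex lines -/

theorem norm_orthPart_le_norm (x v : HomCoord N) : ‖orthPart x v‖ ≤ ‖v‖ := by
  rcases eq_or_ne x 0 with rfl | hx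
  · simp [orthPart]
  · have h := norm_orthPart_sq x v hx
    have h2 : 0 ≤ ‖(inner ℂ x v : ℂ)‖ ^ 2 / ‖x‖ ^ 2 := by positivity
    exact le_of_sq_le_sq (by linarith) (norm_nonneg _)

theorem orthPart_sub_smul (x v : HomCoord N) (c : ℂ) : orthPart x (v - c • x) = orthPart x v := by
  rw [sub_eq_add_neg, ← neg_smul, orthPart_add, orthPart_smul, orthPart_self, smul_zero, add_zero]

/-- `‖orthPart x v‖` is the distance from `v` to the line through `x`. -/
theorem norm_orthPart_le (x v : HomCoord N) (c : ℂ) : ‖orthPart x v‖ ≤ ‖v - c • x‖ := by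
  rw [← orthPart_sub_smul x v c]
  exact norm_orthPart_le_norm _ _

theorem exists_orthPart_eq (x v : HomCoord N) :
    ∃ c : ℂ, orthPart x v = v - c • x ∧ ‖c • x‖ ≤ ‖v‖ := by
  refine ⟨_, rfl, ?_⟩
  rcases eq_or_ne x 0 with rfl | hx
  · simp
  have h : 0 < ‖x‖ := norm_pos_iff.2 hx
  rw [norm_smul, norm_div, norm_pow, Complex.norm_real, norm_norm, div_mul_eq_mul_div,
    div_le_iff₀ (by positivity)]
  nlinarith [norm_inner_le_norm (𝕜 := ℂ) x v]

/-- The sine of the angle between the complex lines through `x` and `y`. -/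
noncomputable def sinDist (x y : HomCoord N) : ℝ := ‖orthPart x y‖ / ‖y‖

theorem sinDist_nonneg (x y : HomCoord N) : 0 ≤ sinDist x y := by unfold sinDist; positivity

theorem sinDist_mul_norm (x y : HomCoord N) (hy : y ≠ 0) :
    sinDist x y * ‖y‖ = ‖orthPart x y‖ :=
  div_mul_cancel₀ _ (norm_ne_zero_iff.2 hy)

theorem sinDist_le_one (x y : HomCoord N) : sinDist x y ≤ 1 :=
  div_le_one_of_le₀ (norm_orthPart_le_norm _ _) (norm_nonneg _)

theorem sinDist_le (x y : HomCoord N) (c : ℂ) :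
    sinDist x y ≤ ‖y - c • x‖ / ‖y‖ :=
  div_le_div_of_nonneg_right (norm_orthPart_le x y c) (norm_nonneg _)

theorem sinDist_smul (x y : HomCoord N) {a b : ℂ} (ha : a ≠ 0) (hb : b ≠ 0) :
    sinDist (a • x) (b • y) = sinDist x y := by
  unfold sinDist
  rw [orthPart_smul_left _ _ _ ha, orthPart_smul, norm_smul, norm_smul,
    mul_div_mul_left _ _ (norm_ne_zero_iff.2 hb)]

/-- Successive projection: `z = c y + o` and `y = d x + o'` give `z - c d x = o + c o'`, and the
error `c o'` is controlled because `‖c y‖ ≤ ‖z‖`. -/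
theorem sinDist_triangle (x y z : HomCoord N) (hy : y ≠ 0) (hz : z ≠ 0) :
    sinDist x z ≤ sinDist x y + sinDist y z := by
  obtain ⟨c, hc, hc'⟩ := exists_orthPart_eq y z
  obtain ⟨d, hd, -⟩ := exists_orthPart_eq x y
  have hz' : 0 < ‖z‖ := norm_pos_iff.2 hz
  refine (sinDist_le x z (c * d)).trans ?_
  rw [div_le_iff₀ hz', add_mul, sinDist_mul_norm y z hz]
  have e : z - (c * d) • x = orthPart y z + c • orthPart x y := by
    rw [hc, hd, smul_sub, smul_smul]; abel
  rw [e]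
  refine (norm_add_le _ _).trans ?_
  rw [norm_smul, ← sinDist_mul_norm x y hy]
  rw [norm_smul] at hc'
  nlinarith [sinDist_nonneg x y]

theorem sqrt_pi_lt_two : Real.sqrt Real.pi < 2 := by
  rw [Real.sqrt_lt' (by norm_num)]
  linarith [Real.pi_lt_four]

theorem one_lt_sqrt_pi : 1 < Real.sqrt Real.pi := by
  rw [Real.lt_sqrt (by norm_num)]
  linarith [Real.pi_gt_three]

/-- This and the next lemma let the whole argument run with the sine in place of the angle. Here
`sin t ≤ t` and `√π < 2` suffice. -/
theorem sinDist_le_fsDistCoord (x y : HomCoord N) (hx : x ≠ 0) (hy : y ≠ 0) :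
    sinDist x y ≤ 2 * fsDistCoord x y := by
  have h0 := sinDist_nonneg x y
  have h1 := sinDist_le_one x y
  rw [fsDistCoord_eq_arcsin x y hx hy]
  change sinDist x y ≤ 2 * (Real.arcsin (sinDist x y) / _)
  have ha : sinDist x y ≤ Real.arcsin (sinDist x y) := by
    conv_lhs => rw [← Real.sin_arcsin (by linarith) h1]
    exact Real.sin_le (Real.arcsin_nonneg.2 h0)
  have hp := one_lt_sqrt_pi
  have hp' := sqrt_pi_lt_two
  rw [mul_div_assoc', le_div_iff₀ (by linarith)]
  nlinarith

/-- Jordan's inequality `2 t / π ≤ sin t` leaves the factor `√π / 2 < 1`. -/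
theorem fsDistCoord_le_sinDist (x y : HomCoord N) (hx : x ≠ 0) (hy : y ≠ 0) :
    fsDistCoord x y ≤ sinDist x y := by
  have h0 := sinDist_nonneg x y
  have h1 := sinDist_le_one x y
  rw [fsDistCoord_eq_arcsin x y hx hy]
  change Real.arcsin (sinDist x y) / _ ≤ _
  have hp := one_lt_sqrt_pi
  have hp' := sqrt_pi_lt_two
  have hpi := Real.pi_pos
  have ha : 2 / Real.pi * Real.arcsin (sinDist x y) ≤ sinDist x y := by
    conv_rhs => rw [← Real.sin_arcsin (by linarith) h1]
    exact Real.mul_le_sin (Real.arcsin_nonneg.2 h0) (Real.arcsin_le_pi_div_two _)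
  rw [div_mul_eq_mul_div, div_le_iff₀ hpi] at ha
  rw [div_le_iff₀ (by linarith)]
  nlinarith [Real.sq_sqrt hpi.le,
    mul_nonneg h0 (mul_nonneg (sub_nonneg.2 hp.le) (sub_nonneg.2 hp'.le)),
    mul_nonneg h0 (mul_nonneg (Real.sqrt_nonneg Real.pi) (sub_nonneg.2 hp'.le))]

theorem dFS_nonneg (p q : CP N) : 0 ≤ dFS p q :=
  div_nonneg (Real.arccos_nonneg _) (Real.sqrt_nonneg _)

theorem dFS_le_one (p q : CP N) : dFS p q ≤ 1 :=
  (fsDistCoord_le_sinDist _ _ p.rep_nonzero q.rep_nonzero).trans (sinDist_le_one _ _)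

theorem bddAbove_dFS {ι : Sort*} (p q : ι → CP N) :
    BddAbove (Set.range fun i => dFS (p i) (q i)) :=
  ⟨1, by rintro _ ⟨i, rfl⟩; exact dFS_le_one _ _⟩

theorem dFS_le_dC (f g : ℂ → CP N) (z : ℂ) : dFS (f z) (g z) ≤ dC f g :=
  le_ciSup (bddAbove_dFS f g) z

/-- The sine of the angle between two points of projective space. -/
noncomputable def sinDistCP (p q : CP N) : ℝ := sinDist p.rep q.rep

theorem sinDistCP_mk (x y : HomCoord N) (hx : x ≠ 0) (hy : y ≠ 0) :
    sinDistCP (Projectivization.mk ℂ x hx) (Projectivization.mk ℂ y hy) = sinDist x y := by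
  obtain ⟨a, ha⟩ := Projectivization.exists_smul_eq_mk_rep ℂ x hx
  obtain ⟨b, hb⟩ := Projectivization.exists_smul_eq_mk_rep ℂ y hy
  unfold sinDistCP
  rw [← ha, ← hb]
  exact sinDist_smul x y a.ne_zero b.ne_zero

theorem sinDistCP_nonneg (p q : CP N) : 0 ≤ sinDistCP p q := sinDist_nonneg _ _

theorem sinDistCP_triangle (p q r : CP N) : sinDistCP p r ≤ sinDistCP p q + sinDistCP q r :=
  sinDist_triangle _ _ _ q.rep_nonzero r.rep_nonzero

theorem sinDistCP_le_dFS (p q : CP N) : sinDistCP p q ≤ 2 * dFS p q :=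
  sinDist_le_fsDistCoord _ _ p.rep_nonzero q.rep_nonzero

theorem dFS_le_sinDistCP (p q : CP N) : dFS p q ≤ sinDistCP p q :=
  fsDistCoord_le_sinDist _ _ p.rep_nonzero q.rep_nonzero

theorem sinDistCP_self (p : CP N) : sinDistCP p p = 0 := by
  simp [sinDistCP, sinDist, orthPart_self]

/-! ### Linear maps -/

theorem norm_orthPart_map_le (M : HomCoord N →L[ℂ] HomCoord N) (x v : HomCoord N) :
    ‖orthPart (M x) (M v)‖ ≤ ‖M‖ * ‖orthPart x v‖ := by
  obtain ⟨c, hc, -⟩ := exists_orthPart_eq x v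
  refine (norm_orthPart_le _ _ c).trans ?_
  rw [← map_smul, ← map_sub, ← hc]
  exact M.le_opNorm _

theorem le_norm_orthPart_map (M : HomCoord N →L[ℂ] HomCoord N) {m : ℝ} (hm : 0 ≤ m)
    (hM : ∀ w, m * ‖w‖ ≤ ‖M w‖) (x v : HomCoord N) :
    m * ‖orthPart x v‖ ≤ ‖orthPart (M x) (M v)‖ := by
  obtain ⟨c, hc, -⟩ := exists_orthPart_eq (M x) (M v)
  rw [hc, ← map_smul, ← map_sub]
  exact (mul_le_mul_of_nonneg_left (norm_orthPart_le x v c) hm).trans (hM _)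

/-- Meant for the derivative `A F' + A' F` of a lift `A F`, with `w = A' F` as the error. -/
theorem fsNorm_map_le (M : HomCoord N →L[ℂ] HomCoord N) {x v w : HomCoord N} {m K e : ℝ}
    (hx : x ≠ 0) (hm : 0 < m) (hMx : m * ‖x‖ ≤ ‖M x‖) (hK : ‖M‖ ≤ K) (hw : ‖w‖ ≤ e * ‖x‖) :
    fsNorm (M x) (M v + w) ≤ K / m * fsNorm x v + e / m := by
  have hx' : 0 < ‖x‖ := norm_pos_iff.2 hx
  have hp := one_lt_sqrt_pi
  have h1 : ‖orthPart (M x) (M v + w)‖ ≤ K * ‖orthPart x v‖ + e * ‖x‖ := by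
    rw [orthPart_add]
    refine (norm_add_le _ _).trans (add_le_add ?_ ((norm_orthPart_le_norm _ _).trans hw))
    exact (norm_orthPart_map_le M x v).trans
      (mul_le_mul_of_nonneg_right hK (norm_nonneg _))
  have hK0 : 0 ≤ K := (norm_nonneg _).trans hK
  have he : 0 ≤ e := by
    by_contra h
    have := norm_nonneg w
    nlinarith
  unfold fsNorm
  have hsp : (0 : ℝ) < Real.sqrt Real.pi := by linarith
  calc ‖orthPart (M x) (M v + w)‖ / (Real.sqrt Real.pi * ‖M x‖)
      ≤ (K * ‖orthPart x v‖ + e * ‖x‖) / (Real.sqrt Real.pi * (m * ‖x‖)) := by gcongr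
    _ = K / m * (‖orthPart x v‖ / (Real.sqrt Real.pi * ‖x‖)) + e / m / Real.sqrt Real.pi := by
        field_simp
    _ ≤ _ := add_le_add le_rfl (div_le_self (by positivity) hp.le)

theorem le_fsNorm_map (M : HomCoord N →L[ℂ] HomCoord N) {x v w : HomCoord N} {m K e : ℝ}
    (hx : x ≠ 0) (hm : 0 < m) (hM : ∀ y, m * ‖y‖ ≤ ‖M y‖) (hK : ‖M‖ ≤ K) (hw : ‖w‖ ≤ e * ‖x‖) :
    m / K * fsNorm x v - e / m ≤ fsNorm (M x) (M v + w) := by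
  have hx' : 0 < ‖x‖ := norm_pos_iff.2 hx
  have hp := one_lt_sqrt_pi
  have hK0 : 0 < K := by
    have := (hM x).trans (M.le_of_opNorm_le hK x)
    nlinarith
  have he : 0 ≤ e := by
    by_contra h
    have := norm_nonneg w
    nlinarith
  have hsp : (0 : ℝ) < Real.sqrt Real.pi := by linarith
  have hMx := hM x
  have hMx0 : 0 < ‖M x‖ := by nlinarith
  have h1 : m * ‖orthPart x v‖ - e * ‖x‖ ≤ ‖orthPart (M x) (M v + w)‖ := by
    rw [orthPart_add]
    have h2 := le_norm_orthPart_map M hm.le hM x v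
    have h3 := (norm_orthPart_le_norm (M x) w).trans hw
    have h4 := norm_sub_le (orthPart (M x) (M v) + orthPart (M x) w) (orthPart (M x) w)
    rw [add_sub_cancel_right] at h4
    linarith
  unfold fsNorm
  have h5 : m / K * (‖orthPart x v‖ / (Real.sqrt Real.pi * ‖x‖)) ≤
      m * ‖orthPart x v‖ / (Real.sqrt Real.pi * ‖M x‖) := by
    calc _ = m * ‖orthPart x v‖ / (Real.sqrt Real.pi * (K * ‖x‖)) := by field_simp
      _ ≤ _ := by gcongr; exact M.le_of_opNorm_le hK x
  have h6 : e * ‖x‖ / (Real.sqrt Real.pi * ‖M x‖) ≤ e / m := by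
    calc _ ≤ e * ‖x‖ / (1 * (m * ‖x‖)) := by gcongr
      _ = _ := by field_simp
  have h7 : (m * ‖orthPart x v‖ - e * ‖x‖) / (Real.sqrt Real.pi * ‖M x‖) ≤
      ‖orthPart (M x) (M v + w)‖ / (Real.sqrt Real.pi * ‖M x‖) := by gcongr
  rw [sub_div] at h7
  linarith

/-- The lower bound on `M` is required at `y` only. Near a pole the condition number of the operator
is unbounded, but the vectors over the curve are stretched about as much as the norm allows. -/
theorem sinDist_map_le (M : HomCoord N →L[ℂ] HomCoord N) {x y : HomCoord N} {m K : ℝ}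
    (hm : 0 < m) (hy : y ≠ 0) (hMy : m * ‖y‖ ≤ ‖M y‖) (hK : ‖M‖ ≤ K) :
    sinDist (M x) (M y) ≤ K / m * sinDist x y := by
  have hy' : 0 < ‖y‖ := norm_pos_iff.2 hy
  have hK0 : 0 ≤ K := (norm_nonneg _).trans hK
  unfold sinDist
  calc _ ≤ K * ‖orthPart x y‖ / (m * ‖y‖) := by
        gcongr
        exact (norm_orthPart_map_le M x y).trans (mul_le_mul_of_nonneg_right hK (norm_nonneg _))
    _ = _ := by field_simp

theorem sinDist_le_map (M : HomCoord N →L[ℂ] HomCoord N) {x y : HomCoord N} {m K : ℝ}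
    (hm : 0 < m) (hy : y ≠ 0) (hM : ∀ w, m * ‖w‖ ≤ ‖M w‖) (hK : ‖M‖ ≤ K) :
    sinDist x y ≤ K / m * sinDist (M x) (M y) := by
  have hy' : 0 < ‖y‖ := norm_pos_iff.2 hy
  have hK0 : 0 ≤ K := (norm_nonneg _).trans hK
  have hMy := hM y
  have hMy0 : 0 < ‖M y‖ := by nlinarith
  unfold sinDist
  rw [div_mul_div_comm, div_le_div_iff₀ hy' (by positivity)]
  have h1 := le_norm_orthPart_map M hm.le hM x y
  have h2 := M.le_of_opNorm_le hK y
  calc _ = (m * ‖orthPart x y‖) * ‖M y‖ := by ring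
    _ ≤ ‖orthPart (M x) (M y)‖ * (K * ‖y‖) := by gcongr
    _ = _ := by ring

/-! ### Continuity of the speed and the length estimate -/

theorem IsLiftAt.eventually {f : ℂ → CP N} {z : ℂ} {F : ℂ → HomCoord N} (h : IsLiftAt f z F) :
    ∀ᶠ w in 𝓝 z, IsLiftAt f w F :=
  h.1.eventually_analyticAt.and (eventually_eventually_nhds.2 h.2)

theorem fsNorm_nonneg (x v : HomCoord N) : 0 ≤ fsNorm x v := by unfold fsNorm; positivity

theorem speed_nonneg (f : ℂ → CP N) (z : ℂ) : 0 ≤ speed f z := by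
  unfold speed
  split_ifs
  exacts [fsNorm_nonneg _ _, le_rfl]

theorem continuousAt_fsNorm {F G : ℂ → HomCoord N} {z : ℂ} (hF : ContinuousAt F z)
    (hG : ContinuousAt G z) (hz : F z ≠ 0) : ContinuousAt (fun w => fsNorm (F w) (G w)) z := by
  have h1 : ‖F z‖ ≠ 0 := norm_ne_zero_iff.2 hz
  have h2 : ((‖F z‖ : ℝ) : ℂ) ^ 2 ≠ 0 := pow_ne_zero 2 (by exact_mod_cast h1)
  have h3 : Real.sqrt Real.pi * ‖F z‖ ≠ 0 :=
    mul_ne_zero (by linarith [one_lt_sqrt_pi]) h1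
  have hn : ContinuousAt (fun w => ((‖F w‖ : ℝ) : ℂ) ^ 2) z :=
    (Complex.continuous_ofReal.continuousAt.comp hF.norm).pow 2
  exact ((hG.sub (((hF.inner (𝕜 := ℂ) hG).div hn h2).smul hF)).norm).div
    (continuousAt_const.mul hF.norm) h3

theorem continuous_speed {f : ℂ → CP N} (hf : IsHolomorphicCurve f) : Continuous (speed f) := by
  refine continuous_iff_continuousAt.2 fun z => ?_
  obtain ⟨F, hF⟩ := hf z
  have h := continuousAt_fsNorm hF.1.continuousAt hF.1.deriv.continuousAt hF.2.self_of_nhds.1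
  refine h.congr ?_
  filter_upwards [hF.eventually] with w hw
  exact (speed_eq hw).symm

theorem continuous_sinDistCP {f : ℂ → CP N} (hf : IsHolomorphicCurve f) (p : CP N) :
    Continuous fun z => sinDistCP p (f z) := by
  refine continuous_iff_continuousAt.2 fun z => ?_
  obtain ⟨F, hF⟩ := hf z
  have hc : Continuous (orthPart p.rep) := by unfold orthPart; fun_prop
  have h : ContinuousAt (fun w => sinDist p.rep (F w)) z :=
    (hc.continuousAt.comp hF.1.continuousAt).norm.div hF.1.continuousAt.norm
      (norm_ne_zero_iff.2 hF.2.self_of_nhds.1)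
  refine h.congr ?_
  filter_upwards [hF.2] with w hw
  obtain ⟨h0, e⟩ := hw
  rw [e]
  conv_rhs => rw [← Projectivization.mk_rep p]
  exact (sinDistCP_mk _ _ p.rep_nonzero h0).symm

/-- The speed bounds right difference quotients along the segment from `a` to `z`, and comparison
with a linear function integrates this. The factor 2 is that of `sinDistCP_le_dFS`. -/
theorem sinDistCP_le_of_speed_le {f : ℂ → CP N} (hf : IsHolomorphicCurve f) {a z : ℂ} {c : ℝ}
    (hc : ∀ w, ‖w - a‖ ≤ ‖z - a‖ → speed f w ≤ c) :
    sinDistCP (f a) (f z) ≤ 2 * c * ‖z - a‖ := by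
  rcases eq_or_ne z a with rfl | hza
  · simp [sinDistCP_self]
  have hd : 0 < ‖z - a‖ := norm_pos_iff.2 (sub_ne_zero.2 hza)
  set γ : ℝ → ℂ := fun t => a + t * (z - a) with hγ
  have hγc : Continuous γ := by fun_prop
  have key := image_le_of_liminf_slope_right_le_deriv_boundary
    (f := fun t => sinDistCP (f a) (f (γ t))) (a := 0) (b := 1)
    ((continuous_sinDistCP hf (f a)).comp hγc).continuousOn
    (B := fun t => 2 * c * ‖z - a‖ * t) (B' := fun _ => 2 * c * ‖z - a‖)
    (by simp [hγ, sinDistCP_self]) (by fun_prop)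
    (fun x _ => by
      simpa using ((hasDerivAt_id x).const_mul (2 * c * ‖z - a‖)).hasDerivWithinAt)
    (fun t ht r hr => by
      apply Eventually.frequently
      have hsub : ∀ t', γ t' - γ t = ((t' - t : ℝ) : ℂ) * (z - a) := by
        intro t'; simp only [hγ]; push_cast; ring
      have htend : Tendsto γ (𝓝[>] t) (𝓝[≠] (γ t)) := by
        refine tendsto_nhdsWithin_iff.2
          ⟨hγc.continuousAt.tendsto.mono_left nhdsWithin_le_nhds, ?_⟩
        filter_upwards [self_mem_nhdsWithin] with t' ht'
        have h1 : ((t' - t : ℝ) : ℂ) ≠ 0 := by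
          exact_mod_cast (sub_pos.2 ht').ne'
        exact sub_ne_zero.1 (by rw [hsub]; exact mul_ne_zero h1 (sub_ne_zero.2 hza))
      have hsp : speed f (γ t) ≤ c := by
        apply hc
        simp only [hγ, add_sub_cancel_left, norm_mul, Complex.norm_real, Real.norm_eq_abs,
          abs_of_nonneg ht.1]
        nlinarith [ht.2]
      have hlt : speed f (γ t) < r / (2 * ‖z - a‖) := by
        refine hsp.trans_lt ?_
        rw [lt_div_iff₀ (by positivity)]
        linarith
      filter_upwards [((tendsto_speed hf (γ t)).comp htend).eventually (gt_mem_nhds hlt),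
        self_mem_nhdsWithin] with t' h1 h2
      have h2' : 0 < t' - t := sub_pos.2 h2
      rw [slope_def_field, div_lt_iff₀ h2']
      simp only [Function.comp] at h1
      rw [hsub, norm_mul, Complex.norm_real, Real.norm_eq_abs, abs_of_pos h2',
        div_lt_div_iff₀ (by positivity) (by positivity)] at h1
      have h3 := sinDistCP_triangle (f a) (f (γ t)) (f (γ t'))
      have h4 := sinDistCP_le_dFS (f (γ t)) (f (γ t'))
      have h5 : dFS (f (γ t)) (f (γ t')) * 2 < r * (t' - t) := by
        by_contra hcon
        push Not at hcon
        nlinarith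
      linarith)
  have := key (x := 1) (by simp)
  simpa [hγ] using this

/-! ### Lifts normalised in a direction -/

/-- The representative of `g z` whose component along `v` is one. -/
noncomputable def normLift (v : HomCoord N) (g : ℂ → CP N) (z : ℂ) : HomCoord N :=
  (inner ℂ v (g z).rep)⁻¹ • (g z).rep

theorem normLift_eq {v : HomCoord N} {g : ℂ → CP N} {z : ℂ} {y : HomCoord N} (hy : y ≠ 0)
    (h : g z = Projectivization.mk ℂ y hy) : normLift v g z = (inner ℂ v y)⁻¹ • y := by
  obtain ⟨a, ha⟩ := Projectivization.exists_smul_eq_mk_rep ℂ y hy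
  unfold normLift
  rw [h, ← ha]
  change (inner ℂ v ((a : ℂ) • y))⁻¹ • (a : ℂ) • y = _
  rw [inner_smul_right, smul_smul, mul_inv]
  congr 1
  have := a.ne_zero
  field_simp

theorem norm_inner_of_unit {v y : HomCoord N} (hv : ‖v‖ = 1) :
    ‖y - orthPart v y‖ = ‖(inner ℂ v y : ℂ)‖ := by
  simp [orthPart, hv, norm_smul]

theorem le_norm_inner_of_sinDist_le {v y : HomCoord N} (hv : ‖v‖ = 1) (hy : y ≠ 0)
    (h : sinDist v y ≤ 1 / 5) : 4 / 5 * ‖y‖ ≤ ‖(inner ℂ v y : ℂ)‖ := by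
  rw [← norm_inner_of_unit hv]
  have h1 := sinDist_mul_norm v y hy
  have h2 := norm_sub_norm_le y (orthPart v y)
  nlinarith [norm_nonneg y]

theorem inner_rep_ne_zero {v : HomCoord N} {p : CP N} (hv : ‖v‖ = 1)
    (h : sinDist v p.rep ≤ 1 / 5) : (inner ℂ v p.rep : ℂ) ≠ 0 := by
  have h1 := le_norm_inner_of_sinDist_le hv p.rep_nonzero h
  have h2 : 0 < ‖p.rep‖ := norm_pos_iff.2 p.rep_nonzero
  exact norm_pos_iff.1 (by linarith)

theorem inner_normLift {v : HomCoord N} {g : ℂ → CP N} {z : ℂ} (hv : ‖v‖ = 1)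
    (h : sinDist v (g z).rep ≤ 1 / 5) : inner ℂ v (normLift v g z) = 1 := by
  unfold normLift
  rw [inner_smul_right, inv_mul_cancel₀ (inner_rep_ne_zero hv h)]

theorem orthPart_normLift {v : HomCoord N} {g : ℂ → CP N} {z : ℂ} (hv : ‖v‖ = 1)
    (h : sinDist v (g z).rep ≤ 1 / 5) : orthPart v (normLift v g z) = normLift v g z - v := by
  simp [orthPart, inner_normLift hv h, hv]

/-- The part orthogonal to `v` is at most `1/5` of the norm and the part along `v` at least `4/5`,
whence the ratio `1/4`. -/
theorem norm_normLift_sub_le {v : HomCoord N} {g : ℂ → CP N} {z : ℂ} (hv : ‖v‖ = 1)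
    (h : sinDist v (g z).rep ≤ 1 / 5) : ‖normLift v g z - v‖ ≤ 1 / 4 := by
  have h1 := le_norm_inner_of_sinDist_le hv (g z).rep_nonzero h
  have h2 : 0 < ‖(inner ℂ v (g z).rep : ℂ)‖ := norm_pos_iff.2 (inner_rep_ne_zero hv h)
  have h3 := sinDist_mul_norm v _ (g z).rep_nonzero
  rw [← orthPart_normLift hv h]
  unfold normLift
  rw [orthPart_smul, norm_smul, norm_inv, ← h3, inv_mul_le_iff₀ h2]
  nlinarith [norm_nonneg (g z).rep]

theorem normLift_ne_zero {v : HomCoord N} {g : ℂ → CP N} {z : ℂ} (hv : ‖v‖ = 1)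
    (h : sinDist v (g z).rep ≤ 1 / 5) : normLift v g z ≠ 0 := by
  intro h0
  have := inner_normLift hv h
  simp [h0] at this

theorem mk_normLift {v : HomCoord N} {g : ℂ → CP N} {z : ℂ} (hv : ‖v‖ = 1)
    (h : sinDist v (g z).rep ≤ 1 / 5) :
    Projectivization.mk ℂ (normLift v g z) (normLift_ne_zero hv h) = g z := by
  conv_rhs => rw [← Projectivization.mk_rep (g z)]
  exact (Projectivization.mk_eq_mk_iff' ℂ _ _ _ _).2 ⟨(inner ℂ v (g z).rep)⁻¹, rfl⟩

theorem isLiftAt_normLift {v : HomCoord N} {g : ℂ → CP N} {z : ℂ} (hg : IsHolomorphicCurve g)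
    (hv : ‖v‖ = 1) (h : sinDist v (g z).rep ≤ 1 / 5) : IsLiftAt g z (normLift v g) := by
  obtain ⟨F, hF⟩ := hg z
  obtain ⟨hFz, ez⟩ := hF.2.self_of_nhds
  let ℓ : HomCoord N →L[ℂ] ℂ := innerSL ℂ v
  have hℓF : AnalyticAt ℂ (fun w => ℓ (F w)) z := (ℓ.analyticAt _).comp hF.1
  have hℓz : ℓ (F z) ≠ 0 := by
    intro h0
    have h1 := inner_normLift hv h
    rw [normLift_eq hFz ez, inner_smul_right] at h1
    change inner ℂ v (F z) = 0 at h0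
    simp [h0] at h1
  have hne : ∀ᶠ w in 𝓝 z, ℓ (F w) ≠ 0 := hℓF.continuousAt.eventually_ne hℓz
  have hev : ∀ᶠ w in 𝓝 z, (ℓ (F w))⁻¹ • F w = normLift v g w := by
    filter_upwards [hF.2] with w hw
    obtain ⟨h0, e⟩ := hw
    exact (normLift_eq h0 e).symm
  refine ⟨((hℓF.inv hℓz).smul hF.1).congr hev, ?_⟩
  filter_upwards [hF.2, hne, hev] with w hw hn he
  obtain ⟨h0, e⟩ := hw
  have h1 : normLift v g w ≠ 0 := by
    rw [← he]; exact smul_ne_zero (inv_ne_zero hn) h0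
  refine ⟨h1, ?_⟩
  rw [e]
  refine (Projectivization.mk_eq_mk_iff' ℂ _ _ _ _).2 ⟨ℓ (F w), ?_⟩
  rw [← he, smul_smul, mul_inv_cancel₀ hn, one_smul]

/-! ### Sums over separated sets -/

/-- Each term is at most 8 times the integral of the same function over a disk of radius `1/2`.
These disks are disjoint, and the exponent 3 exceeds the dimension 2. -/
theorem exists_sum_one_add_norm_le : ∃ C : ℝ, 0 < C ∧ ∀ (T : Finset ℂ) (w : ℂ),
    (T : Set ℂ).Pairwise (fun a b => 1 ≤ dist a b) →
      ∑ b ∈ T, (1 + ‖w - b‖) ^ (-3 : ℝ) ≤ C := by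
  have hint : Integrable (fun y : ℂ => (1 + ‖y‖) ^ (-3 : ℝ)) :=
    integrable_one_add_norm (by rw [Complex.finrank_real_complex]; norm_num)
  have hnn : ∀ y : ℂ, 0 ≤ (1 + ‖y‖) ^ (-3 : ℝ) := fun y => by positivity
  refine ⟨(∫ y : ℂ, (1 + ‖y‖) ^ (-3 : ℝ)) * 8 + 1,
    by have := integral_nonneg (μ := (volume : Measure ℂ)) (Pi.le_def.2 hnn); positivity,
    fun T w hT => ?_⟩
  have hintw : Integrable (fun y : ℂ => (1 + ‖w - y‖) ^ (-3 : ℝ)) := hint.comp_sub_left w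
  have hvol : ∀ b : ℂ, volume.real (Metric.ball b (1 / 2)) = Real.pi / 4 := by
    intro b
    rw [Measure.real, Complex.volume_ball, ENNReal.toReal_mul, ENNReal.toReal_pow,
      ENNReal.toReal_ofReal (by norm_num)]
    simp; ring
  have hdisj : (T : Set ℂ).Pairwise
      (Function.onFun Disjoint fun b => Metric.ball b (1 / 2 : ℝ)) := by
    intro a ha b hb hab
    exact Metric.ball_disjoint_ball (by linarith [hT ha hb hab])
  have hterm : ∀ b ∈ T, (1 + ‖w - b‖) ^ (-3 : ℝ) ≤
      8 * ∫ y in Metric.ball b (1 / 2), (1 + ‖w - y‖) ^ (-3 : ℝ) := by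
    intro b _
    have h1 : ∫ _ in Metric.ball b (1 / 2), (1 + ‖w - b‖) ^ (-3 : ℝ) * (8 / 27) ≤
        ∫ y in Metric.ball b (1 / 2), (1 + ‖w - y‖) ^ (-3 : ℝ) := by
      refine setIntegral_mono_on (integrableOn_const (by finiteness)) hintw.integrableOn
        Metric.isOpen_ball.measurableSet fun y hy => ?_
      have h2 : ‖w - y‖ ≤ ‖w - b‖ + 1 / 2 := by
        have h3 : ‖b - y‖ < 1 / 2 := by
          rw [← dist_eq_norm, dist_comm]; exact hy
        have := norm_add_le (w - b) (b - y)
        rw [sub_add_sub_cancel] at this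
        linarith
      have h0 := norm_nonneg (w - b)
      have h0' := norm_nonneg (w - y)
      rw [Real.rpow_neg (by positivity), Real.rpow_neg (by positivity)]
      norm_cast
      rw [inv_mul_eq_div, div_le_iff₀ (by positivity), inv_mul_eq_div, le_div_iff₀ (by positivity)]
      have h4 : (1 + ‖w - y‖) ^ 3 ≤ (3 / 2 * (1 + ‖w - b‖)) ^ 3 := by gcongr; linarith
      rw [mul_pow] at h4
      linarith
    rw [setIntegral_const, hvol, smul_eq_mul] at h1
    have h5 := Real.pi_gt_three
    have h6 := hnn (w - b)
    nlinarith
  calc _ ≤ ∑ b ∈ T, 8 * ∫ y in Metric.ball b (1 / 2), (1 + ‖w - y‖) ^ (-3 : ℝ) :=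
        Finset.sum_le_sum hterm
    _ = 8 * ∫ y in ⋃ b ∈ T, Metric.ball b (1 / 2), (1 + ‖w - y‖) ^ (-3 : ℝ) := by
        rw [← Finset.mul_sum, integral_biUnion_finset T
          (fun _ _ => Metric.isOpen_ball.measurableSet) hdisj (fun _ _ => hintw.integrableOn)]
    _ ≤ 8 * ∫ y : ℂ, (1 + ‖w - y‖) ^ (-3 : ℝ) := by
        refine mul_le_mul_of_nonneg_left ?_ (by norm_num)
        exact setIntegral_le_integral hintw (ae_of_all _ fun y => hnn (w - y))
    _ = 8 * ∫ y : ℂ, (1 + ‖y‖) ^ (-3 : ℝ) := by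
        rw [integral_sub_left_eq_self (fun y : ℂ => (1 + ‖y‖) ^ (-3 : ℝ))]
    _ ≤ _ := by linarith

theorem exists_sum_inv_norm_le : ∃ C : ℝ, 0 < C ∧ ∀ (R : ℝ) (T : Finset ℂ) (w : ℂ), 0 < R →
    (T : Set ℂ).Pairwise (fun a b => R ≤ dist a b) → (∀ b ∈ T, R / 4 ≤ ‖w - b‖) →
      ∑ b ∈ T, 8000 / ‖w - b‖ ^ 3 ≤ C / R ^ 3 := by
  classical
  obtain ⟨C, hC, h⟩ := exists_sum_one_add_norm_le
  refine ⟨1000000 * C, by positivity, fun R T w hR hT hw => ?_⟩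
  have hRc : (R : ℂ) ≠ 0 := by exact_mod_cast hR.ne'
  have hinj : Function.Injective fun b : ℂ => b / (R : ℂ) := fun a b hab => by
    simpa [div_left_inj' hRc] using hab
  have h1 := h (T.image fun b => b / (R : ℂ)) (w / R) (by
    intro a ha b hb hab
    simp only [Finset.coe_image, Set.mem_image, Finset.mem_coe] at ha hb
    obtain ⟨a, ha, rfl⟩ := ha
    obtain ⟨b, hb, rfl⟩ := hb
    have := hT ha hb (fun e => hab (by rw [e]))
    rw [dist_eq_norm, ← sub_div, norm_div, Complex.norm_real, Real.norm_eq_abs, abs_of_pos hR,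
      le_div_iff₀ hR, ← dist_eq_norm]
    linarith)
  rw [Finset.sum_image hinj.injOn] at h1
  have h2 : ∀ b ∈ T, 8000 / ‖w - b‖ ^ 3 ≤
      1000000 / R ^ 3 * (1 + ‖w / R - b / R‖) ^ (-3 : ℝ) := by
    intro b hb
    have hb' := hw b hb
    have hpos : 0 < ‖w - b‖ := by linarith
    rw [← sub_div, norm_div, Complex.norm_real, Real.norm_eq_abs, abs_of_pos hR,
      Real.rpow_neg (by positivity)]
    norm_cast
    rw [← div_eq_mul_inv, div_div, ← mul_pow, div_le_div_iff₀ (by positivity) (by positivity)]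
    have e : R * (1 + ‖w - b‖ / R) = R + ‖w - b‖ := by field_simp
    rw [e]
    -- `R ≤ 4 ‖w - b‖`, and `8000 * 5 ^ 3 = 1000000`.
    have : (R + ‖w - b‖) ^ 3 ≤ (5 * ‖w - b‖) ^ 3 := by gcongr; linarith
    rw [mul_pow] at this
    linarith
  calc _ ≤ ∑ b ∈ T, 1000000 / R ^ 3 * (1 + ‖w / R - b / R‖) ^ (-3 : ℝ) := Finset.sum_le_sum h2
    _ ≤ 1000000 / R ^ 3 * C := by rw [← Finset.mul_sum]; gcongr
    _ = _ := by ring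

/-! ### Sums of rank-one operators with triple poles -/

/-- The operator `x ↦ 8000 (w - b)⁻³ ⟨v b, x⟩ u b`. -/
noncomputable def poleOp (u v : ℂ → HomCoord N) (b w : ℂ) : HomCoord N →L[ℂ] HomCoord N :=
  (8000 / (w - b) ^ 3 : ℂ) • (innerSL ℂ (v b)).smulRight (u b)

/-- The sum of the operators `poleOp` over a set of poles. -/
noncomputable def poleSum (u v : ℂ → HomCoord N) (Λ : Set ℂ) (w : ℂ) :
    HomCoord N →L[ℂ] HomCoord N :=
  ∑' b : Λ, poleOp u v b w

theorem poleOp_apply (u v : ℂ → HomCoord N) (b w : ℂ) (x : HomCoord N) :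
    poleOp u v b w x = (8000 / (w - b) ^ 3 : ℂ) • (inner ℂ (v b) x : ℂ) • u b := rfl

theorem norm_poleOp {u v : ℂ → HomCoord N} (hu : ∀ b, ‖u b‖ = 1) (hv : ∀ b, ‖v b‖ = 1)
    (b w : ℂ) : ‖poleOp u v b w‖ = 8000 / ‖w - b‖ ^ 3 := by
  unfold poleOp
  rw [norm_smul, ContinuousLinearMap.norm_smulRight_apply, innerSL_apply_norm, hu, hv, norm_div,
    norm_pow]
  simp

/-- A uniform bound for sums of third powers over `R`-separated sets. -/
def IsSumBound (C : ℝ) : Prop :=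
  0 < C ∧ ∀ (R : ℝ) (Λ : Set ℂ) (w : ℂ), 0 < R → Λ.Pairwise (fun a b => R ≤ dist a b) →
    (∀ b ∈ Λ, R / 4 ≤ ‖w - b‖) →
      (Summable fun b : Λ => 8000 / ‖w - b‖ ^ 3) ∧ ∑' b : Λ, 8000 / ‖w - b‖ ^ 3 ≤ C / R ^ 3

theorem exists_isSumBound : ∃ C, IsSumBound C := by
  obtain ⟨C, hC, h⟩ := exists_sum_inv_norm_le
  refine ⟨C, hC, fun R Λ w hR hΛ hw => ?_⟩
  have h0 : 0 ≤ fun b : Λ => 8000 / ‖w - b‖ ^ 3 := fun b => by positivity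
  have h1 : ∀ T : Finset Λ, ∑ b ∈ T, 8000 / ‖w - b‖ ^ 3 ≤ C / R ^ 3 := by
    intro T
    have := h R (T.map (Function.Embedding.subtype _)) w hR (by
      intro a ha b hb hab
      simp only [Finset.coe_map, Set.mem_image, Finset.mem_coe] at ha hb
      obtain ⟨a, -, rfl⟩ := ha
      obtain ⟨b, -, rfl⟩ := hb
      exact hΛ a.2 b.2 hab) (by
      intro b hb
      simp only [Finset.mem_map] at hb
      obtain ⟨b, -, rfl⟩ := hb
      exact hw b b.2)
    simpa using this
  exact ⟨summable_of_sum_le h0 h1, Real.tsum_le_of_sum_le h0 h1⟩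

section

variable {u v : ℂ → HomCoord N} {C R : ℝ} {Λ : Set ℂ}

theorem summable_poleOp (hu : ∀ b, ‖u b‖ = 1) (hv : ∀ b, ‖v b‖ = 1) (hC : IsSumBound C)
    (hR : 0 < R) (hΛ : Λ.Pairwise (fun a b => R ≤ dist a b)) {w : ℂ}
    (hw : ∀ b ∈ Λ, R / 4 ≤ ‖w - b‖) : Summable fun b : Λ => poleOp u v b w :=
  Summable.of_norm_bounded (hC.2 R Λ w hR hΛ hw).1 fun b => (norm_poleOp hu hv b w).le

theorem norm_poleSum_le (hu : ∀ b, ‖u b‖ = 1) (hv : ∀ b, ‖v b‖ = 1) (hC : IsSumBound C)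
    (hR : 0 < R) (hΛ : Λ.Pairwise (fun a b => R ≤ dist a b)) {w : ℂ}
    (hw : ∀ b ∈ Λ, R / 4 ≤ ‖w - b‖) : ‖poleSum u v Λ w‖ ≤ C / R ^ 3 :=
  (tsum_of_norm_bounded (hC.2 R Λ w hR hΛ hw).1.hasSum
    fun b => (norm_poleOp hu hv b w).le).trans (hC.2 R Λ w hR hΛ hw).2

theorem le_norm_sub_of_mem_ball {z w b : ℂ} (hz : R / 2 ≤ ‖z - b‖)
    (hw : w ∈ Metric.ball z (R / 4)) : R / 4 ≤ ‖w - b‖ ∧ ‖z - b‖ / 2 ≤ ‖w - b‖ := by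
  have h1 : ‖z - w‖ < R / 4 := by rw [← dist_eq_norm, dist_comm]; exact hw
  have h2 := norm_add_le (z - w) (w - b)
  rw [sub_add_sub_cancel] at h2
  constructor <;> linarith

theorem differentiableOn_poleSum (hu : ∀ b, ‖u b‖ = 1) (hv : ∀ b, ‖v b‖ = 1)
    (hC : IsSumBound C) (hR : 0 < R) (hΛ : Λ.Pairwise (fun a b => R ≤ dist a b)) {z : ℂ}
    (hz : ∀ b ∈ Λ, R / 2 ≤ ‖z - b‖) :
    DifferentiableOn ℂ (poleSum u v Λ) (Metric.ball z (R / 4)) := by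
  have hs := (hC.2 R Λ z hR hΛ (fun b hb => by linarith [hz b hb])).1
  refine Complex.differentiableOn_tsum_of_summable_norm (hs.mul_left 8) (fun b => ?_)
    Metric.isOpen_ball fun b w hw => ?_
  · intro w hw
    have h1 := (le_norm_sub_of_mem_ball (hz b b.2) hw).1
    have h2 : (w - b) ^ 3 ≠ 0 := pow_ne_zero 3 (norm_pos_iff.1 (by linarith))
    unfold poleOp
    exact ((DifferentiableAt.div (𝕜 := ℂ) (differentiableAt_const _) (by fun_prop)
      h2).smul_const _).differentiableWithinAt
  · have h1 := (le_norm_sub_of_mem_ball (hz b b.2) hw).2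
    have h2 := hz b b.2
    have h3 : 0 < ‖z - b‖ := by linarith
    rw [norm_poleOp hu hv]
    calc 8000 / ‖w - b‖ ^ 3 ≤ 8000 / (‖z - b‖ / 2) ^ 3 := by gcongr
      _ = _ := by field_simp; norm_num

theorem analyticAt_poleSum (hu : ∀ b, ‖u b‖ = 1) (hv : ∀ b, ‖v b‖ = 1)
    (hC : IsSumBound C) (hR : 0 < R) (hΛ : Λ.Pairwise (fun a b => R ≤ dist a b)) {z : ℂ}
    (hz : ∀ b ∈ Λ, R / 2 ≤ ‖z - b‖) : AnalyticAt ℂ (poleSum u v Λ) z :=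
  (differentiableOn_poleSum hu hv hC hR hΛ hz).analyticAt
    (Metric.ball_mem_nhds z (by positivity))

theorem norm_deriv_le_of_forall_mem_ball {F : Type*} [NormedAddCommGroup F] [NormedSpace ℂ F]
    [CompleteSpace F] {f : ℂ → F} {z : ℂ} {r K : ℝ} (hr : 0 < r)
    (hf : DifferentiableOn ℂ f (Metric.ball z r)) (hK : ∀ w ∈ Metric.ball z r, ‖f w‖ ≤ K) :
    ‖deriv f z‖ ≤ 2 * K / r := by
  have h := Complex.norm_deriv_le_of_forall_mem_sphere_norm_le (c := z) (f := f) (half_pos hr)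
    (C := K) (DifferentiableOn.diffContOnCl (hf.mono (by
      rw [closure_ball _ (half_pos hr).ne']
      exact Metric.closedBall_subset_ball (by linarith))))
    (fun w hw => hK w (Metric.sphere_subset_closedBall.trans
      (Metric.closedBall_subset_ball (by linarith)) hw))
  refine h.trans (le_of_eq ?_)
  field_simp

/-- Cauchy's estimate on a disk of radius comparable to `R` gains a factor `1 / R` over the bound
for the sum itself. Nondegeneracy needs this gain. -/
theorem norm_deriv_poleSum_le (hu : ∀ b, ‖u b‖ = 1) (hv : ∀ b, ‖v b‖ = 1)
    (hC : IsSumBound C) (hR : 0 < R) (hΛ : Λ.Pairwise (fun a b => R ≤ dist a b)) {z : ℂ}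
    (hz : ∀ b ∈ Λ, R / 2 ≤ ‖z - b‖) : ‖deriv (poleSum u v Λ) z‖ ≤ 8 * (C / R ^ 3) / R := by
  have := norm_deriv_le_of_forall_mem_ball (by positivity)
    (differentiableOn_poleSum hu hv hC hR hΛ hz) (K := C / R ^ 3)
    (fun w hw => norm_poleSum_le hu hv hC hR hΛ
      fun b hb => (le_norm_sub_of_mem_ball (hz b hb) hw).1)
  refine this.trans (le_of_eq ?_)
  field_simp
  ring

theorem poleSum_eq_add (hu : ∀ b, ‖u b‖ = 1) (hv : ∀ b, ‖v b‖ = 1)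
    (hC : IsSumBound C) (hR : 0 < R) (hΛ : Λ.Pairwise (fun a b => R ≤ dist a b)) {a w : ℂ}
    (ha : a ∈ Λ) (hw : ∀ b ∈ Λ \ {a}, R / 4 ≤ ‖w - b‖) :
    poleSum u v Λ w = poleOp u v a w + poleSum u v (Λ \ {a}) w := by
  have h1 := Summable.tsum_union_disjoint (f := fun b => poleOp u v b w) (s := {a})
    (t := Λ \ {a}) Set.disjoint_sdiff_right (Set.Finite.summable (Set.finite_singleton a) _)
    (summable_poleOp hu hv hC hR (hΛ.mono Set.sdiff_subset) hw)
  rw [tsum_singleton a (fun b => poleOp u v b w)] at h1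
  rwa [Set.union_sdiff_cancel (Set.singleton_subset_iff.2 ha)] at h1

end

/-- Maximal separated subsets exist. -/
theorem exists_maximal_separated (Z : Set ℂ) (R : ℝ) :
    ∃ Λ ⊆ Z, Λ.Pairwise (fun a b => R ≤ dist a b) ∧ ∀ z ∈ Z, z ∈ Λ ∨ ∃ a ∈ Λ, dist z a < R := by
  obtain ⟨Λ, hΛ⟩ := zorn_subset {Λ : Set ℂ | Λ ⊆ Z ∧ Λ.Pairwise (fun a b => R ≤ dist a b)}
    (fun c hc hchain => ⟨⋃₀ c, ⟨Set.sUnion_subset fun s hs => (hc hs).1,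
      (Set.pairwise_sUnion hchain.directedOn).2 fun s hs => (hc hs).2⟩,
      fun s hs => Set.subset_sUnion_of_mem hs⟩)
  refine ⟨Λ, hΛ.prop.1, hΛ.prop.2, fun z hz => ?_⟩
  by_contra! h
  have hins : insert z Λ ∈ {Λ : Set ℂ | Λ ⊆ Z ∧ Λ.Pairwise (fun a b => R ≤ dist a b)} :=
    ⟨Set.insert_subset hz hΛ.prop.1, hΛ.prop.2.insert fun b hb _ =>
      ⟨h.2 b hb, by rw [dist_comm]; exact h.2 b hb⟩⟩
  exact h.1 (hΛ.le_of_ge hins (Set.subset_insert z Λ) (Set.mem_insert z Λ))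

theorem analyticAt_clm_apply {E F : Type*} [NormedAddCommGroup E] [NormedSpace ℂ E]
    [NormedAddCommGroup F] [NormedSpace ℂ F] {A : ℂ → E →L[ℂ] F} {f : ℂ → E} {z : ℂ}
    (hA : AnalyticAt ℂ A z) (hf : AnalyticAt ℂ f z) : AnalyticAt ℂ (fun w => A w (f w)) z :=
  ((ContinuousLinearMap.id ℂ (E →L[ℂ] F)).analyticAt_bilinear (A z, f z)).comp₂ hA hf

/-! ### Deforming a curve by inserting poles -/

/-- Widely separated poles, each with an orthonormal pair of directions. -/
structure PoleConfig (N : ℕ) (C R : ℝ) where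
  u : ℂ → HomCoord N
  v : ℂ → HomCoord N
  poles : Set ℂ
  norm_u : ∀ b, ‖u b‖ = 1
  norm_v : ∀ b, ‖v b‖ = 1
  inner_v_u : ∀ b, inner ℂ (v b) (u b) = 0
  separated : poles.Pairwise fun a b => R ≤ dist a b
  sumBound : IsSumBound C
  large : 100 ≤ R
  small : C / R ^ 3 ≤ 1 / 100000

namespace PoleConfig

theorem pos {C R : ℝ} (D : PoleConfig N C R) : 0 < R := by linarith [D.large]

theorem eps_nonneg {C R : ℝ} (D : PoleConfig N C R) : 0 ≤ C / R ^ 3 := by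
  have := D.pos
  have := D.sumBound.1
  positivity

variable {C R : ℝ} (D : PoleConfig N C R)

/-- The sum of the pole operators away from the pole `a`. -/
noncomputable def err (a w : ℂ) : HomCoord N →L[ℂ] HomCoord N :=
  poleSum D.u D.v (D.poles \ {a}) w

/-- The operator field that deforms curves, away from the poles. -/
noncomputable def op (w : ℂ) : HomCoord N →L[ℂ] HomCoord N := 1 + poleSum D.u D.v D.poles w

open Classical in
/-- Homogeneous coordinates of the deformed curve. -/
noncomputable def vec (w : ℂ) (x : HomCoord N) : HomCoord N :=
  -- At a pole, division by zero makes the singular term of `op` vanish. The correct value is the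
  -- limit of `(w - a)³ / 8000` times the operator.
  if w ∈ D.poles then (inner ℂ (D.v w) x : ℂ) • D.u w else D.op w x

open Classical in
/-- The deformed curve. -/
noncomputable def deform (g : ℂ → CP N) (z : ℂ) : CP N :=
  -- The default value never occurs for admissible `g`.
  if h : D.vec z (g z).rep ≠ 0 then Projectivization.mk ℂ _ h else g z

/-- The curves that stay close to the direction `v a` on the disk of radius `R` around each
pole `a`. -/
structure Admissible (g : ℂ → CP N) : Prop where
  holo : IsHolomorphicCurve g
  near : ∀ a ∈ D.poles, ∀ z, ‖z - a‖ ≤ R → sinDist (D.v a) (g z).rep ≤ 1 / 5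

theorem vec_smul (w : ℂ) (c : ℂ) (x : HomCoord N) : D.vec w (c • x) = c • D.vec w x := by
  unfold vec
  split_ifs
  · rw [inner_smul_right, smul_smul]
  · rw [map_smul]

theorem deform_eq {g : ℂ → CP N} {z : ℂ} {x y : HomCoord N} (hx : x ≠ 0)
    (hg : g z = Projectivization.mk ℂ x hx) {c : ℂ} (hc : c ≠ 0) (hy : y ≠ 0)
    (h : y = c • D.vec z x) : D.deform g z = Projectivization.mk ℂ y hy := by
  obtain ⟨a, ha⟩ := Projectivization.exists_smul_eq_mk_rep ℂ x hx
  have h1 : D.vec z (g z).rep = (a : ℂ) • D.vec z x := by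
    rw [hg, ← ha, ← D.vec_smul]; rfl
  have hv : D.vec z x ≠ 0 := by
    rintro h0; exact hy (by rw [h, h0, smul_zero])
  have h2 : D.vec z (g z).rep ≠ 0 := by rw [h1]; exact smul_ne_zero a.ne_zero hv
  unfold deform
  rw [dif_pos h2]
  refine (Projectivization.mk_eq_mk_iff' ℂ _ _ _ _).2 ⟨a * c⁻¹, ?_⟩
  rw [h, smul_smul, mul_assoc, inv_mul_cancel₀ hc, mul_one, h1]

/-- Away from the poles the operator is close to the identity. -/
theorem norm_op_sub_one_le {w : ℂ} (hw : ∀ b ∈ D.poles, R / 4 ≤ ‖w - b‖) :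
    ‖D.op w - 1‖ ≤ C / R ^ 3 := by
  unfold op
  rw [add_sub_cancel_left]
  exact norm_poleSum_le D.norm_u D.norm_v D.sumBound D.pos D.separated hw

theorem le_norm_op_outer {w : ℂ} (hw : ∀ b ∈ D.poles, R / 4 ≤ ‖w - b‖) (x : HomCoord N) :
    (1 - C / R ^ 3) * ‖x‖ ≤ ‖D.op w x‖ := by
  have h1 := (D.op w - 1).le_of_opNorm_le (D.norm_op_sub_one_le hw) x
  have h2 : (D.op w - 1) x = D.op w x - x := rfl
  have h3 := norm_sub_norm_le x (D.op w x)
  rw [norm_sub_rev, ← h2] at h3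
  linarith

theorem norm_op_outer_le {w : ℂ} (hw : ∀ b ∈ D.poles, R / 4 ≤ ‖w - b‖) :
    ‖D.op w‖ ≤ 1 + C / R ^ 3 := by
  have h1 := norm_add_le (1 : HomCoord N →L[ℂ] HomCoord N) (D.op w - 1)
  rw [add_sub_cancel] at h1
  have h2 : ‖(1 : HomCoord N →L[ℂ] HomCoord N)‖ ≤ 1 := ContinuousLinearMap.norm_id_le
  linarith [D.norm_op_sub_one_le hw]

theorem notMem_poles {w : ℂ} {d : ℝ} (hd : 0 < d) (hw : ∀ b ∈ D.poles, d ≤ ‖w - b‖) :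
    w ∉ D.poles := by
  intro h
  have := hw w h
  simp at this
  linarith

theorem op_ne_zero_outer {w : ℂ} (hw : ∀ b ∈ D.poles, R / 4 ≤ ‖w - b‖) {x : HomCoord N}
    (hx : x ≠ 0) : D.op w x ≠ 0 := by
  have h1 := D.le_norm_op_outer hw x
  have h2 := D.small
  have h3 : 0 < ‖x‖ := norm_pos_iff.2 hx
  exact norm_pos_iff.1 (by nlinarith)

theorem isLiftAt_outer {g : ℂ → CP N} {z : ℂ} {F : ℂ → HomCoord N} (hF : IsLiftAt g z F)
    (hz : ∀ b ∈ D.poles, R / 2 ≤ ‖z - b‖) :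
    IsLiftAt (D.deform g) z fun w => D.op w (F w) := by
  have hR := D.pos
  have hA : AnalyticAt ℂ D.op z :=
    analyticAt_const.add
      (analyticAt_poleSum D.norm_u D.norm_v D.sumBound D.pos D.separated hz)
  refine ⟨analyticAt_clm_apply hA hF.1, ?_⟩
  filter_upwards [hF.2, Metric.ball_mem_nhds z (by positivity : 0 < R / 4)] with w hw hwz
  obtain ⟨h0, e⟩ := hw
  have hw' : ∀ b ∈ D.poles, R / 4 ≤ ‖w - b‖ :=
    fun b hb => (le_norm_sub_of_mem_ball (hz b hb) hwz).1
  refine ⟨D.op_ne_zero_outer hw' h0, D.deform_eq h0 e one_ne_zero _ ?_⟩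
  rw [one_smul, vec, if_neg (D.notMem_poles (by positivity) hw')]

/-! ### The deformed curve near a pole -/

theorem far_of_near {a z : ℂ} (ha : a ∈ D.poles) (hz : ‖z - a‖ < R / 2) :
    ∀ b ∈ D.poles \ {a}, R / 2 ≤ ‖z - b‖ := by
  intro b hb
  have h1 := D.separated hb.1 ha hb.2
  have h2 := norm_sub_le (z - a) (z - b)
  rw [sub_sub_sub_cancel_left, ← dist_eq_norm] at h2
  linarith

theorem separated_diff (a : ℂ) : (D.poles \ {a}).Pairwise fun a b => R ≤ dist a b :=
  D.separated.mono Set.sdiff_subset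

theorem op_eq {a z : ℂ} (ha : a ∈ D.poles) (hz : ‖z - a‖ < R / 2) :
    D.op z = 1 + poleOp D.u D.v a z + D.err a z := by
  have hR := D.pos
  unfold op err
  rw [poleSum_eq_add D.norm_u D.norm_v D.sumBound D.pos D.separated ha
    (fun b hb => by linarith [D.far_of_near ha hz b hb]), add_assoc]

theorem norm_err_le {a z : ℂ} (ha : a ∈ D.poles) (hz : ‖z - a‖ < R / 2) :
    ‖D.err a z‖ ≤ C / R ^ 3 := by
  have hR := D.pos
  exact norm_poleSum_le D.norm_u D.norm_v D.sumBound D.pos (D.separated_diff a)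
    (fun b hb => by linarith [D.far_of_near ha hz b hb])

/-- A lift of the deformed curve near the pole `a`. -/
noncomputable def innerLift (g : ℂ → CP N) (a w : ℂ) : HomCoord N :=
  (w - a) ^ 3 • (normLift (D.v a) g w + D.err a w (normLift (D.v a) g w)) + (8000 : ℂ) • D.u a

variable {D}

theorem norm_normLift_le {g : ℂ → CP N} (hg : D.Admissible g) {a z : ℂ} (ha : a ∈ D.poles)
    (hz : ‖z - a‖ ≤ R) : ‖normLift (D.v a) g z‖ ≤ 5 / 4 := by
  have h1 := norm_normLift_sub_le (D.norm_v a) (hg.near a ha z hz)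
  have h2 := norm_sub_norm_le (normLift (D.v a) g z) (D.v a)
  rw [D.norm_v] at h2
  linarith

theorem norm_err_normLift_le {g : ℂ → CP N} (hg : D.Admissible g) {a z : ℂ} (ha : a ∈ D.poles)
    (hz : ‖z - a‖ < R / 2) : ‖D.err a z (normLift (D.v a) g z)‖ ≤ 1 / 50 := by
  have h1 := (D.err a z).le_of_opNorm_le ((D.norm_err_le ha hz).trans D.small)
    (normLift (D.v a) g z)
  have h2 := norm_normLift_le hg ha (z := z) (by linarith [D.pos])
  linarith

/-- The term `8000 u a` is orthogonal to `v a`, so this component is `(z - a)³` up to a relative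
error of `1/50`. -/
theorem le_norm_inner_innerLift {g : ℂ → CP N} (hg : D.Admissible g) {a z : ℂ}
    (ha : a ∈ D.poles) (hz : ‖z - a‖ < R / 2) :
    49 / 50 * ‖z - a‖ ^ 3 ≤ ‖(inner ℂ (D.v a) (D.innerLift g a z) : ℂ)‖ := by
  have hR := D.pos
  have hv := D.norm_v a
  have hWn := norm_err_normLift_le hg ha hz
  have e1 : inner ℂ (D.v a) (D.innerLift g a z)
      = (z - a) ^ 3 * (1 + inner ℂ (D.v a) (D.err a z (normLift (D.v a) g z))) := by
    rw [innerLift, inner_add_right, inner_smul_right, inner_smul_right, D.inner_v_u, mul_zero,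
      add_zero, inner_add_right, inner_normLift hv (hg.near a ha z (by linarith))]
  set W := D.err a z (normLift (D.v a) g z)
  have b3 := norm_inner_le_norm (𝕜 := ℂ) (D.v a) W
  rw [hv, one_mul] at b3
  rw [e1, norm_mul, norm_pow, mul_comm]
  gcongr
  have := norm_sub_le ((1 : ℂ) + inner ℂ (D.v a) W) (inner ℂ (D.v a) W)
  rw [add_sub_cancel_right, norm_one] at this
  linarith

/-- The component along `v a` is at least `0.98 r³` and the one along `u a` at least `8000 - 0.27
r³`, where `r = ‖z - a‖` and `0.27 = 1/4 + 1/50`. Weights `2/3` and `1/3` give the bound. -/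
theorem le_norm_innerLift {g : ℂ → CP N} (hg : D.Admissible g) {a z : ℂ} (ha : a ∈ D.poles)
    (hz : ‖z - a‖ < R / 2) : (8000 + ‖z - a‖ ^ 3) / 3 ≤ ‖D.innerLift g a z‖ := by
  have hR := D.pos
  have hu := D.norm_u a
  have c1 := le_norm_inner_innerLift hg ha hz
  have b1 := norm_inner_le_norm (𝕜 := ℂ) (D.v a) (D.innerLift g a z)
  rw [D.norm_v, one_mul] at b1
  have hF2 := norm_normLift_sub_le (D.norm_v a) (hg.near a ha z (by linarith))
  have hWn := norm_err_normLift_le hg ha hz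
  have e2 : inner ℂ (D.u a) (D.innerLift g a z)
      = (z - a) ^ 3 * (inner ℂ (D.u a) (normLift (D.v a) g z - D.v a) +
        inner ℂ (D.u a) (D.err a z (normLift (D.v a) g z))) + 8000 := by
    rw [innerLift, inner_add_right, inner_smul_right, inner_smul_right,
      inner_self_eq_norm_sq_to_K, hu, inner_add_right, inner_sub_right,
      inner_eq_zero_symm.1 (D.inner_v_u a)]
    simp
  have b2 := norm_inner_le_norm (𝕜 := ℂ) (D.u a) (D.innerLift g a z)
  set W := D.err a z (normLift (D.v a) g z)
  set ξ := normLift (D.v a) g z - D.v a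
  have b4 := norm_inner_le_norm (𝕜 := ℂ) (D.u a) W
  have b5 := norm_inner_le_norm (𝕜 := ℂ) (D.u a) ξ
  rw [hu, one_mul] at b2 b4 b5
  have c2 : 8000 - 27 / 100 * ‖z - a‖ ^ 3 ≤ ‖D.innerLift g a z‖ := by
    refine le_trans ?_ b2
    rw [e2]
    set X := (z - a) ^ 3 * (inner ℂ (D.u a) ξ + inner ℂ (D.u a) W) with hX
    have h1 : ‖X‖ ≤ 27 / 100 * ‖z - a‖ ^ 3 := by
      rw [hX, norm_mul, norm_pow, mul_comm]
      gcongr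
      exact (norm_add_le _ _).trans (by linarith)
    have h2 := norm_sub_le (X + 8000) X
    rw [add_sub_cancel_left] at h2
    have h3 : ‖(8000 : ℂ)‖ = 8000 := by simp
    linarith
  have : 0 ≤ ‖z - a‖ ^ 3 := by positivity
  linarith

theorem innerLift_ne_zero {g : ℂ → CP N} (hg : D.Admissible g) {a z : ℂ} (ha : a ∈ D.poles)
    (hz : ‖z - a‖ < R / 2) : D.innerLift g a z ≠ 0 := by
  have h1 := le_norm_innerLift hg ha hz
  have h2 : 0 ≤ ‖z - a‖ ^ 3 := by positivity
  exact norm_pos_iff.1 (by linarith)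

theorem innerLift_eq_op {g : ℂ → CP N} {a z : ℂ} (ha : a ∈ D.poles)
    (hg : D.Admissible g) (hz : ‖z - a‖ < R / 2) (hza : z ≠ a) :
    D.innerLift g a z = (z - a) ^ 3 • D.op z (normLift (D.v a) g z) := by
  have hR := D.pos
  have h0 : (z - a) ^ 3 ≠ 0 := pow_ne_zero 3 (sub_ne_zero.2 hza)
  rw [D.op_eq ha hz, innerLift]
  change _ = (z - a) ^ 3 • (normLift (D.v a) g z + poleOp D.u D.v a z (normLift (D.v a) g z)
    + D.err a z (normLift (D.v a) g z))
  rw [poleOp_apply, inner_normLift (D.norm_v a) (hg.near a ha z (by linarith)), one_smul,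
    add_right_comm, smul_add _ _ ((8000 / (z - a) ^ 3 : ℂ) • D.u a), smul_smul,
    mul_div_cancel₀ _ h0]

theorem notMem_poles_of_near {a z : ℂ} (ha : a ∈ D.poles) (hz : ‖z - a‖ < R / 2) (hza : z ≠ a) :
    z ∉ D.poles := by
  have hR := D.pos
  intro h
  have := D.far_of_near ha hz z ⟨h, hza⟩
  simp at this
  linarith

theorem deform_inner {g : ℂ → CP N} (hg : D.Admissible g) {a z : ℂ} (ha : a ∈ D.poles)
    (hz : ‖z - a‖ < R / 2) :
    D.deform g z = Projectivization.mk ℂ (D.innerLift g a z) (innerLift_ne_zero hg ha hz) := by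
  have hR := D.pos
  have hnear := hg.near a ha z (by linarith)
  have hv := D.norm_v a
  rcases eq_or_ne z a with rfl | hza
  · refine D.deform_eq (normLift_ne_zero hv hnear) (mk_normLift hv hnear).symm
      (c := 8000) (by norm_num) _ ?_
    rw [vec, if_pos ha, inner_normLift hv hnear]
    simp [innerLift]
  · refine D.deform_eq (normLift_ne_zero hv hnear) (mk_normLift hv hnear).symm
      (c := (z - a) ^ 3) (pow_ne_zero 3 (sub_ne_zero.2 hza)) _ ?_
    rw [vec, if_neg (notMem_poles_of_near ha hz hza), innerLift_eq_op ha hg hz hza]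

theorem analyticAt_err {a z : ℂ} (ha : a ∈ D.poles) (hz : ‖z - a‖ < R / 2) :
    AnalyticAt ℂ (D.err a) z :=
  analyticAt_poleSum D.norm_u D.norm_v D.sumBound D.pos (D.separated_diff a)
    (D.far_of_near ha hz)

theorem analyticAt_normLift {g : ℂ → CP N} (hg : D.Admissible g) {a z : ℂ} (ha : a ∈ D.poles)
    (hz : ‖z - a‖ ≤ R) : AnalyticAt ℂ (normLift (D.v a) g) z :=
  (isLiftAt_normLift hg.holo (D.norm_v a) (hg.near a ha z hz)).1

theorem isLiftAt_inner {g : ℂ → CP N} (hg : D.Admissible g) {a z : ℂ} (ha : a ∈ D.poles)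
    (hz : ‖z - a‖ < R / 2) : IsLiftAt (D.deform g) z (D.innerLift g a) := by
  have hR := D.pos
  have hF := analyticAt_normLift hg ha (z := z) (by linarith)
  constructor
  · exact (((analyticAt_id.sub analyticAt_const).pow 3).smul
      (hF.add (analyticAt_clm_apply (analyticAt_err ha hz) hF))).add analyticAt_const
  · have hopen : ∀ᶠ w in 𝓝 z, ‖w - a‖ < R / 2 :=
      (by fun_prop : Continuous fun w : ℂ => ‖w - a‖).continuousAt.eventually_lt
        continuousAt_const hz
    filter_upwards [hopen] with w hw
    exact ⟨innerLift_ne_zero hg ha hw, deform_inner hg ha hw⟩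

variable (D) in
theorem outer_or_inner (z : ℂ) :
    (∀ b ∈ D.poles, R / 2 ≤ ‖z - b‖) ∨ ∃ a ∈ D.poles, ‖z - a‖ < R / 2 := by
  by_contra! h
  obtain ⟨⟨b, hb, hb'⟩, h2⟩ := h
  linarith [h2 b hb]

theorem isHolomorphicCurve_deform {g : ℂ → CP N} (hg : D.Admissible g) :
    IsHolomorphicCurve (D.deform g) := by
  intro z
  rcases D.outer_or_inner z with h | ⟨a, ha, h⟩
  · obtain ⟨F, hF⟩ := hg.holo z
    exact ⟨_, D.isLiftAt_outer hF h⟩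
  · exact ⟨_, isLiftAt_inner hg ha h⟩

end PoleConfig

theorem fsNorm_le_div (x v : HomCoord N) : fsNorm x v ≤ ‖v‖ / ‖x‖ := by
  have h1 := one_lt_sqrt_pi
  unfold fsNorm
  rw [← div_div]
  gcongr
  exact (div_le_self (norm_nonneg _) h1.le).trans (norm_orthPart_le_norm _ _)

namespace PoleConfig

variable {C R : ℝ} {D : PoleConfig N C R}

/-! ### The speed of the deformed curve -/

/-- The additive error in the lower bound is of size `ε / R` with `ε = C / R ^ 3`, so it can be
absorbed when `speed g z` is only about `1 / (20 * R)`. -/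
theorem speed_deform_outer (D : PoleConfig N C R) {g : ℂ → CP N} (hg : IsHolomorphicCurve g)
    {z : ℂ} (hz : ∀ b ∈ D.poles, R / 2 ≤ ‖z - b‖) :
    speed (D.deform g) z ≤ (1 + 3 * (C / R ^ 3)) * speed g z + C / R ^ 3 ∧
      (1 - 2 * (C / R ^ 3)) * speed g z - 9 * (C / R ^ 3) / R ≤ speed (D.deform g) z := by
  have hR := D.pos
  have hR' := D.large
  have hs := D.small
  have he := D.eps_nonneg
  have hz' : ∀ b ∈ D.poles, R / 4 ≤ ‖z - b‖ := fun b hb => by linarith [hz b hb]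
  obtain ⟨F, hF⟩ := hg z
  have hF0 : F z ≠ 0 := hF.2.self_of_nhds.1
  have hSd := (analyticAt_poleSum D.norm_u D.norm_v D.sumBound D.pos D.separated
    hz).differentiableAt.hasDerivAt
  have hAd : HasDerivAt D.op (deriv (poleSum D.u D.v D.poles) z) z := hSd.const_add 1
  have hd := (hAd.clm_apply hF.1.differentiableAt.hasDerivAt).deriv
  have hspeed := speed_nonneg g z
  rw [speed_eq hF] at hspeed ⊢
  rw [speed_eq (D.isLiftAt_outer hF hz), hd.trans (add_comm _ _)]
  have hw : ‖deriv (poleSum D.u D.v D.poles) z (F z)‖ ≤ 8 * (C / R ^ 3) / R * ‖F z‖ :=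
    ContinuousLinearMap.le_of_opNorm_le _
      (norm_deriv_poleSum_le D.norm_u D.norm_v D.sumBound D.pos D.separated hz) _
  have hK := D.norm_op_outer_le hz'
  set ε := C / R ^ 3 with hε
  have hm : 0 < 1 - ε := by linarith
  have e9 : 8 * ε / R / (1 - ε) ≤ 9 * ε / R := by
    rw [div_right_comm]
    gcongr
    rw [div_le_iff₀ hm]
    nlinarith
  have e1 : 9 * ε / R ≤ ε := by
    rw [div_le_iff₀ hR]; nlinarith
  constructor
  · refine (fsNorm_map_le (D.op z) hF0 hm (D.le_norm_op_outer hz' _) hK hw).trans ?_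
    refine add_le_add (mul_le_mul_of_nonneg_right ?_ hspeed) (e9.trans e1)
    rw [div_le_iff₀ hm]
    nlinarith
  · refine le_trans ?_ (le_fsNorm_map (D.op z) hF0 hm (D.le_norm_op_outer hz') hK hw)
    refine sub_le_sub (mul_le_mul_of_nonneg_right ?_ hspeed) e9
    rw [le_div_iff₀ (by linarith)]
    nlinarith

theorem norm_deriv_normLift_le {g : ℂ → CP N} (hg : D.Admissible g) {a z : ℂ}
    (ha : a ∈ D.poles) (hz : ‖z - a‖ < R / 2) : ‖deriv (normLift (D.v a) g) z‖ ≤ 1 / R := by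
  have hR := D.pos
  have hball : ∀ w ∈ Metric.ball z (R / 2), ‖w - a‖ ≤ R := fun w hw => by
    have h1 : ‖w - z‖ < R / 2 := by rw [← dist_eq_norm]; exact hw
    have h2 := norm_add_le (w - z) (z - a)
    rw [sub_add_sub_cancel] at h2
    linarith
  have h := norm_deriv_le_of_forall_mem_ball (f := fun w => normLift (D.v a) g w - D.v a)
    (z := z) (r := R / 2) (K := 1 / 4) (by positivity)
    (fun w hw => ((analyticAt_normLift hg ha
      (hball w hw)).differentiableAt.sub_const _).differentiableWithinAt)
    (fun w hw => norm_normLift_sub_le (D.norm_v a) (hg.near a ha w (hball w hw)))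
  rw [deriv_sub_const] at h
  refine h.trans (le_of_eq ?_)
  field_simp
  norm_num

/-- Bounds the derivative of `innerLift` divided by its norm. The first term comes from
differentiating `(z - a)³`, the second from the slowly varying `F + E F`. -/
theorem speed_deform_inner {g : ℂ → CP N} (hg : D.Admissible g) {a z : ℂ} (ha : a ∈ D.poles)
    (hz : ‖z - a‖ < R / 2) :
    speed (D.deform g) z ≤ 27 / 2 * ‖z - a‖ ^ 2 / (8000 + ‖z - a‖ ^ 3) + 6 / R := by
  have hR := D.pos
  have hR' := D.large
  have hs := D.small
  have he := D.eps_nonneg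
  rw [speed_eq (isLiftAt_inner hg ha hz)]
  refine (fsNorm_le_div _ _).trans ?_
  have hG := le_norm_innerLift hg ha hz
  have hF := norm_normLift_le hg ha (z := z) (by linarith)
  have hF' := norm_deriv_normLift_le hg ha hz
  have hE := (D.norm_err_le ha hz).trans hs
  have hE' : ‖deriv (D.err a) z‖ ≤ 8 * (1 / 100000) / R :=
    (norm_deriv_poleSum_le D.norm_u D.norm_v D.sumBound D.pos (D.separated_diff a)
      (D.far_of_near ha hz)).trans (by gcongr)
  have hFd := (analyticAt_normLift hg ha (z := z) (by linarith)).differentiableAt.hasDerivAt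
  have hEd := (analyticAt_err ha hz).differentiableAt.hasDerivAt
  have hd := ((((hasDerivAt_id z).sub_const a).pow 3).smul
    (hFd.add (hEd.clm_apply hFd))).add_const ((8000 : ℂ) • D.u a)
  have hd' : deriv (D.innerLift g a) z =
      (z - a) ^ 3 • (deriv (normLift (D.v a) g) z + (deriv (D.err a) z (normLift (D.v a) g z) +
        D.err a z (deriv (normLift (D.v a) g) z))) +
      (((3 : ℕ) : ℂ) * (z - a) ^ (3 - 1) * 1) •
        (normLift (D.v a) g z + D.err a z (normLift (D.v a) g z)) := hd.deriv
  have e : ((3 : ℕ) : ℂ) * (z - a) ^ (3 - 1) * 1 = 3 * (z - a) ^ 2 := by norm_num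
  rw [e] at hd'
  rw [hd']
  set F := normLift (D.v a) g z
  set F' := deriv (normLift (D.v a) g) z
  set E := D.err a z
  set E' := deriv (D.err a) z
  set r := ‖z - a‖ with hr
  have hr0 : 0 ≤ r := norm_nonneg _
  have n1 : ‖F + E F‖ ≤ 3 / 2 := by
    have h1 := E.le_of_opNorm_le hE F
    have h2 := norm_add_le F (E F)
    linarith
  have n2 : ‖F' + (E' F + E F')‖ ≤ 2 / R := by
    have h1 := E.le_of_opNorm_le hE F'
    have h2 := E'.le_of_opNorm_le hE' F
    have h3 := norm_add_le F' (E' F + E F')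
    have h4 := norm_add_le (E' F) (E F')
    have h5 : 8 * (1 / 100000) / R * ‖F‖ ≤ 8 * (1 / 100000) / R * (5 / 4) := by gcongr
    have h6 : 2 / R = 2 * (1 / R) := by ring
    have h7 : 8 * (1 / 100000) / R = 8 / 100000 * (1 / R) := by ring
    have h8 : 0 < 1 / R := by positivity
    rw [h7] at h5 h2
    rw [h6]
    linarith
  have n3 : ∀ X Y : HomCoord N, ‖X‖ ≤ 2 / R → ‖Y‖ ≤ 3 / 2 →
      ‖(z - a) ^ 3 • X + (3 * (z - a) ^ 2) • Y‖ ≤ r ^ 3 * (2 / R) + 3 * r ^ 2 * (3 / 2) := by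
    intro X Y hX hY
    refine (norm_add_le _ _).trans ?_
    rw [norm_smul, norm_smul, norm_mul, norm_pow, norm_pow, ← hr]
    have : ‖(3 : ℂ)‖ = 3 := by simp
    rw [this]
    gcongr
  have n4 := n3 _ _ n2 n1
  have hpos : 0 < (8000 + r ^ 3) / 3 := by positivity
  have hpos' : 0 < 8000 + r ^ 3 := by positivity
  calc _ ≤ (r ^ 3 * (2 / R) + 3 * r ^ 2 * (3 / 2)) / ((8000 + r ^ 3) / 3) := by
        gcongr
    _ = 27 / 2 * r ^ 2 / (8000 + r ^ 3) + 6 / R * (r ^ 3 / (8000 + r ^ 3)) := by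
        field_simp; ring
    _ ≤ _ := by
        gcongr
        refine mul_le_of_le_one_right (by positivity) ?_
        rw [div_le_one hpos']
        linarith

theorem speed_deform_inner_le_one {g : ℂ → CP N} (hg : D.Admissible g) {a z : ℂ}
    (ha : a ∈ D.poles) (hz : ‖z - a‖ < R / 2) : speed (D.deform g) z ≤ 1 := by
  refine (speed_deform_inner hg ha hz).trans ?_
  have hR := D.large
  have hr := norm_nonneg (z - a)
  set r := ‖z - a‖
  -- Equivalent to `20 r² ≤ 20³ + r³`. The coefficient 8000 is large so that the bubble stays slow.
  have h1 : 27 / 2 * r ^ 2 / (8000 + r ^ 3) ≤ 27 / 40 := by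
    rw [div_le_iff₀ (by positivity)]
    nlinarith [mul_nonneg hr (sq_nonneg (r - 20)), sq_nonneg (r - 20)]
  have h2 : 6 / R ≤ 6 / 100 := by gcongr
  linarith

theorem speed_deform_inner_far {g : ℂ → CP N} (hg : D.Admissible g) {a z : ℂ} {ρ : ℝ}
    (ha : a ∈ D.poles) (hz : ‖z - a‖ < R / 2) (hρ : 0 < ρ) (hρz : ρ ≤ ‖z - a‖) :
    speed (D.deform g) z ≤ 14 / ρ + 6 / R := by
  refine (speed_deform_inner hg ha hz).trans ?_
  set r := ‖z - a‖
  refine add_le_add ?_ le_rfl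
  have hr : 0 < r := by linarith
  rw [div_le_div_iff₀ (by positivity) hρ]
  have : r ^ 2 * ρ ≤ r ^ 2 * r := by gcongr
  have h3 : r ^ 3 = r ^ 2 * r := by ring
  have : 0 < r ^ 2 * r := by positivity
  rw [h3]
  linarith

/-! ### Distances between deformed curves -/

theorem op_bounds_inner {a z : ℂ} (ha : a ∈ D.poles) (hz : ‖z - a‖ < R / 2)
    (hz1 : 1 ≤ ‖z - a‖) : (∀ x, 1 / 20000 * ‖x‖ ≤ ‖D.op z x‖) ∧ ‖D.op z‖ ≤ 10000 := by
  have hs := D.small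
  have hE := (D.norm_err_le ha hz).trans hs
  set P := poleOp D.u D.v a z with hP
  have hPn : ‖P‖ ≤ 8000 := by
    rw [hP, norm_poleOp D.norm_u D.norm_v]
    exact div_le_self (by norm_num) (one_le_pow₀ hz1)
  have hop := D.op_eq ha hz
  have h1 : ‖(1 : HomCoord N →L[ℂ] HomCoord N)‖ ≤ 1 := ContinuousLinearMap.norm_id_le
  constructor
  · intro x
    -- Since `v a` is orthogonal to `u a`, `P² = 0` and `1 + P` has the explicit inverse `1 - P`.
    have hPP : P (P x) = 0 := by
      rw [hP, poleOp_apply, poleOp_apply, inner_smul_right, inner_smul_right, D.inner_v_u]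
      simp
    have e1 : x = (x + P x) - P (x + P x) := by rw [map_add, hPP]; abel
    have e2 : x + P x = D.op z x - D.err a z x := by
      rw [hop]
      change _ = (x + P x + D.err a z x) - _
      abel
    have b1 : ‖x‖ ≤ 8001 * ‖x + P x‖ := by
      have h2 := norm_sub_le (x + P x) (P (x + P x))
      rw [← e1] at h2
      have h3 := P.le_of_opNorm_le hPn (x + P x)
      linarith
    have b2 := norm_sub_le (D.op z x) (D.err a z x)
    rw [← e2] at b2
    have b3 := (D.err a z).le_of_opNorm_le hE x
    have := norm_nonneg x
    linarith
  · rw [hop]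
    have h2 := norm_add_le (1 + P) (D.err a z)
    have h3 := norm_add_le 1 P
    linarith

theorem op_bounds (D : PoleConfig N C R) {z : ℂ} (hz : ∀ b ∈ D.poles, 1 ≤ ‖z - b‖) :
    (∀ x, 1 / 20000 * ‖x‖ ≤ ‖D.op z x‖) ∧ ‖D.op z‖ ≤ 10000 := by
  have hR := D.pos
  have hs := D.small
  rcases D.outer_or_inner z with h | ⟨a, ha, h⟩
  · have h' : ∀ b ∈ D.poles, R / 4 ≤ ‖z - b‖ := fun b hb => by linarith [h b hb]
    refine ⟨fun x => le_trans ?_ (D.le_norm_op_outer h' x),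
      (D.norm_op_outer_le h').trans (by linarith)⟩
    gcongr
    linarith
  · exact op_bounds_inner ha h (hz a ha)

theorem sinDistCP_deform (D : PoleConfig N C R) {g₁ g₂ : ℂ → CP N} {z : ℂ} (hz : z ∉ D.poles)
    (h1 : D.op z (g₁ z).rep ≠ 0) (h2 : D.op z (g₂ z).rep ≠ 0) :
    sinDistCP (D.deform g₁ z) (D.deform g₂ z) =
      sinDist (D.op z (g₁ z).rep) (D.op z (g₂ z).rep) := by
  have e : ∀ (g : ℂ → CP N) (h : D.op z (g z).rep ≠ 0),
      D.deform g z = Projectivization.mk ℂ _ h := fun g h =>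
    D.deform_eq (g z).rep_nonzero (Projectivization.mk_rep _).symm one_ne_zero h
      (by rw [one_smul, vec, if_neg hz])
  rw [e g₁ h1, e g₂ h2, sinDistCP_mk]

/-- With `norm_op_inner_le` this shows that vectors over the curve are stretched by a fixed fraction
of the operator norm, uniformly up to the pole. -/
theorem le_norm_op_inner {g : ℂ → CP N} (hg : D.Admissible g) {a z : ℂ} (ha : a ∈ D.poles)
    (hz : ‖z - a‖ < R / 2) (hza : z ≠ a) :
    4 / 15 * (1 + 8000 / ‖z - a‖ ^ 3) * ‖(g z).rep‖ ≤ ‖D.op z (g z).rep‖ := by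
  have hR := D.pos
  have hnear := hg.near a ha z (by linarith)
  have h1 := le_norm_innerLift hg ha hz
  have h2 := le_norm_inner_of_sinDist_le (D.norm_v a) (g z).rep_nonzero hnear
  have hr : 0 < ‖z - a‖ := norm_pos_iff.2 (sub_ne_zero.2 hza)
  rw [innerLift_eq_op ha hg hz hza, norm_smul, norm_pow, normLift, map_smul, norm_smul,
    norm_inv] at h1
  set r := ‖z - a‖
  have hi : 0 < ‖(inner ℂ (D.v a) (g z).rep : ℂ)‖ :=
    norm_pos_iff.2 (inner_rep_ne_zero (D.norm_v a) hnear)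
  set i := ‖(inner ℂ (D.v a) (g z).rep : ℂ)‖
  have h3 : (1 + 8000 / r ^ 3) / 3 * i ≤ ‖D.op z (g z).rep‖ := by
    have h4 : (8000 + r ^ 3) / 3 * i ≤ r ^ 3 * ‖D.op z (g z).rep‖ := by
      calc _ ≤ r ^ 3 * (i⁻¹ * ‖D.op z (g z).rep‖) * i := by gcongr
        _ = _ := by field_simp
    have h5 : (1 + 8000 / r ^ 3) / 3 * i = (8000 + r ^ 3) / 3 * i / r ^ 3 := by
      field_simp; ring
    rw [h5, div_le_iff₀ (by positivity)]
    linarith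
  refine le_trans ?_ h3
  calc _ = (1 + 8000 / r ^ 3) / 3 * (4 / 5 * ‖(g z).rep‖) := by ring
    _ ≤ _ := by gcongr

theorem norm_op_inner_le {a z : ℂ} (ha : a ∈ D.poles) (hz : ‖z - a‖ < R / 2) :
    ‖D.op z‖ ≤ 2 * (1 + 8000 / ‖z - a‖ ^ 3) := by
  have hs := D.small
  have hE := (D.norm_err_le ha hz).trans hs
  have h1 : ‖(1 : HomCoord N →L[ℂ] HomCoord N)‖ ≤ 1 := ContinuousLinearMap.norm_id_le
  have h2 := norm_add_le (1 + poleOp D.u D.v a z) (D.err a z)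
  have h3 := norm_add_le 1 (poleOp D.u D.v a z)
  rw [norm_poleOp D.norm_u D.norm_v] at h3
  rw [D.op_eq ha hz]
  have : 0 ≤ 8000 / ‖z - a‖ ^ 3 := by positivity
  linarith

theorem op_rep_ne_zero {g : ℂ → CP N} (hg : D.Admissible g) {z : ℂ} (hz : z ∉ D.poles) :
    D.op z (g z).rep ≠ 0 := by
  have hR := D.pos
  rcases D.outer_or_inner z with h | ⟨a, ha, h⟩
  · exact D.op_ne_zero_outer (fun b hb => by linarith [h b hb]) (g z).rep_nonzero
  · have hza : z ≠ a := by rintro rfl; exact hz ha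
    have h1 := le_norm_op_inner hg ha h hza
    have h2 : 0 < ‖(g z).rep‖ := norm_pos_iff.2 (g z).rep_nonzero
    exact norm_pos_iff.1 (lt_of_lt_of_le (by positivity) h1)

theorem sinDistCP_deform_le {g₁ g₂ : ℂ → CP N} (hg₁ : D.Admissible g₁) (hg₂ : D.Admissible g₂)
    (z : ℂ) : sinDistCP (D.deform g₁ z) (D.deform g₂ z) ≤ 8 * sinDistCP (g₁ z) (g₂ z) := by
  have hR := D.pos
  have hs := D.small
  have he := D.eps_nonneg
  have hnn := sinDistCP_nonneg (g₁ z) (g₂ z)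
  by_cases hz : z ∈ D.poles
  -- At a pole both deformed curves pass through `[u z]`, so their distance is zero.
  · have h0 : ‖z - z‖ < R / 2 := by simp [hR]
    rw [deform_inner hg₁ hz h0, deform_inner hg₂ hz h0, sinDistCP_mk]
    simp only [innerLift, sub_self, ne_eq, OfNat.ofNat_ne_zero, not_false_eq_true, zero_pow,
      zero_smul, zero_add]
    rw [sinDist_smul _ _ (by norm_num) (by norm_num)]
    simp only [sinDist, orthPart_self, norm_zero, zero_div]
    positivity
  rw [D.sinDistCP_deform hz (op_rep_ne_zero hg₁ hz) (op_rep_ne_zero hg₂ hz)]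
  rcases D.outer_or_inner z with h | ⟨a, ha, h⟩
  · have h' : ∀ b ∈ D.poles, R / 4 ≤ ‖z - b‖ := fun b hb => by linarith [h b hb]
    refine (sinDist_map_le (D.op z) (by linarith) (g₂ z).rep_nonzero
      (D.le_norm_op_outer h' _) (D.norm_op_outer_le h')).trans ?_
    refine mul_le_mul_of_nonneg_right ?_ hnn
    rw [div_le_iff₀ (by linarith)]
    linarith
  · have hza : z ≠ a := by rintro rfl; exact hz ha
    refine (sinDist_map_le (D.op z) (by positivity) (g₂ z).rep_nonzero
      (le_norm_op_inner hg₂ ha h hza) (norm_op_inner_le ha h)).trans ?_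
    refine mul_le_mul_of_nonneg_right ?_ hnn
    rw [div_le_iff₀ (by positivity)]
    have : 0 ≤ 8000 / ‖z - a‖ ^ 3 := by positivity
    linarith

theorem sinDistCP_le_deform {g₁ g₂ : ℂ → CP N} (hg₁ : D.Admissible g₁) (hg₂ : D.Admissible g₂)
    {z : ℂ} (hz : ∀ b ∈ D.poles, 1 ≤ ‖z - b‖) :
    sinDistCP (g₁ z) (g₂ z) ≤ 200000000 * sinDistCP (D.deform g₁ z) (D.deform g₂ z) := by
  have hz' := D.notMem_poles one_pos hz
  rw [D.sinDistCP_deform hz' (op_rep_ne_zero hg₁ hz') (op_rep_ne_zero hg₂ hz')]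
  obtain ⟨h1, h2⟩ := D.op_bounds hz
  refine (sinDist_le_map (D.op z) (by norm_num) (g₂ z).rep_nonzero h1 h2).trans (le_of_eq ?_)
  norm_num [sinDist]

theorem sinDistCP_le_norm_sub {g₁ g₂ : ℂ → CP N} (hg₁ : D.Admissible g₁)
    (hg₂ : D.Admissible g₂) {a z : ℂ} (ha : a ∈ D.poles) (hz : ‖z - a‖ ≤ R) :
    sinDistCP (g₁ z) (g₂ z) ≤ ‖normLift (D.v a) g₂ z - normLift (D.v a) g₁ z‖ := by
  have hv := D.norm_v a
  have h1 := hg₁.near a ha z hz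
  have h2 := hg₂.near a ha z hz
  rw [← mk_normLift hv h1, ← mk_normLift hv h2, sinDistCP_mk]
  have h3 := sinDist_le (normLift (D.v a) g₁ z) (normLift (D.v a) g₂ z) 1
  rw [one_smul] at h3
  refine h3.trans (div_le_self (norm_nonneg _) ?_)
  have h4 := norm_inner_le_norm (𝕜 := ℂ) (D.v a) (normLift (D.v a) g₂ z)
  rw [inner_normLift hv h2, hv] at h4
  simpa using h4

/-- Write `F₂ = c F₁ + o`. Pairing with `v a`, where both lifts have component one, gives `‖1 - c‖ ≤
‖o‖`, so `F₂ - F₁` is controlled by `o`. -/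
theorem norm_sub_le_sinDistCP {g₁ g₂ : ℂ → CP N} (hg₁ : D.Admissible g₁)
    (hg₂ : D.Admissible g₂) {a z : ℂ} (ha : a ∈ D.poles) (hz : ‖z - a‖ ≤ R) :
    ‖normLift (D.v a) g₂ z - normLift (D.v a) g₁ z‖ ≤ 3 * sinDistCP (g₁ z) (g₂ z) := by
  have hv := D.norm_v a
  have h1 := hg₁.near a ha z hz
  have h2 := hg₂.near a ha z hz
  rw [← mk_normLift hv h1, ← mk_normLift hv h2, sinDistCP_mk]
  have i1 := inner_normLift hv h1
  have i2 := inner_normLift hv h2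
  have n1 := norm_normLift_le hg₁ ha hz
  have n2 := norm_normLift_le hg₂ ha hz
  have hs := sinDist_mul_norm (normLift (D.v a) g₁ z) (normLift (D.v a) g₂ z)
    (normLift_ne_zero hv h2)
  have hnn := sinDist_nonneg (normLift (D.v a) g₁ z) (normLift (D.v a) g₂ z)
  set F₁ := normLift (D.v a) g₁ z
  set F₂ := normLift (D.v a) g₂ z
  obtain ⟨c, hc, -⟩ := exists_orthPart_eq F₁ F₂
  set o := orthPart F₁ F₂
  have e1 : inner ℂ (D.v a) o = 1 - c := by
    rw [hc, inner_sub_right, inner_smul_right, i1, i2, mul_one]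
  have b1 : ‖1 - c‖ ≤ ‖o‖ := by
    rw [← e1]
    simpa [hv] using norm_inner_le_norm (𝕜 := ℂ) (D.v a) o
  have e2 : F₂ - F₁ = o - (1 - c) • F₁ := by
    rw [hc, sub_smul, one_smul]; abel
  rw [e2]
  have b2 := norm_sub_le o ((1 - c) • F₁)
  rw [norm_smul] at b2
  have b3 : ‖1 - c‖ * ‖F₁‖ ≤ ‖o‖ * (5 / 4) := by gcongr
  have b4 : sinDist F₁ F₂ * ‖F₂‖ ≤ sinDist F₁ F₂ * (5 / 4) := by gcongr
  linarith

theorem exists_sinDistCP_le_deform {g₁ g₂ : ℂ → CP N} (hg₁ : D.Admissible g₁)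
    (hg₂ : D.Admissible g₂) {s : ℝ} (z : ℂ)
    (hs : ∀ w, ‖w - z‖ ≤ 3 → sinDistCP (D.deform g₁ w) (D.deform g₂ w) ≤ s) :
    sinDistCP (g₁ z) (g₂ z) ≤ 600000000 * s := by
  have hR := D.large
  have hs0 : 0 ≤ s := (sinDistCP_nonneg _ _).trans (hs z (by simp))
  by_cases hz : ∀ b ∈ D.poles, 1 ≤ ‖z - b‖
  · linarith [sinDistCP_le_deform hg₁ hg₂ hz, hs z (by simp)]
  push Not at hz
  obtain ⟨a, ha, hza⟩ := hz
  have hball : ∀ w ∈ Metric.closedBall a 1, ‖w - a‖ ≤ R := fun w hw => by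
    have : ‖w - a‖ ≤ 1 := by rw [← dist_eq_norm]; exact hw
    linarith
  refine (sinDistCP_le_norm_sub hg₁ hg₂ ha (z := z) (by linarith)).trans ?_
  -- Maximum principle on the unit disk about the pole. Its boundary lies within distance 2 of `z`,
  -- and there the operator is uniformly invertible.
  refine Complex.norm_le_of_forall_mem_frontier_norm_le (U := Metric.ball a 1)
    (f := fun w => normLift (D.v a) g₂ w - normLift (D.v a) g₁ w) Metric.isBounded_ball ?_ ?_ ?_
  · refine DifferentiableOn.diffContOnCl fun w hw => ?_
    rw [closure_ball a one_ne_zero] at hw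
    exact ((analyticAt_normLift hg₂ ha (hball w hw)).differentiableAt.sub
      (analyticAt_normLift hg₁ ha (hball w hw)).differentiableAt).differentiableWithinAt
  · intro w hw
    rw [frontier_ball a one_ne_zero] at hw
    have hwa : ‖w - a‖ = 1 := by rw [← dist_eq_norm]; exact hw
    have hw1 : ∀ b ∈ D.poles, 1 ≤ ‖w - b‖ := by
      intro b hb
      rcases eq_or_ne b a with rfl | hba
      · exact hwa.ge
      · linarith [D.far_of_near ha (z := w) (by linarith) b ⟨hb, hba⟩]
    have hwz : ‖w - z‖ ≤ 3 := by
      have := norm_sub_le (w - a) (z - a)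
      rw [sub_sub_sub_cancel_right] at this
      linarith
    have h1 := norm_sub_le_sinDistCP hg₁ hg₂ ha (z := w) (by linarith)
    have h2 := sinDistCP_le_deform hg₁ hg₂ hw1
    have h3 := hs w hwz
    change ‖normLift (D.v a) g₂ w - normLift (D.v a) g₁ w‖ ≤ _
    linarith
  · rw [closure_ball a one_ne_zero, Metric.mem_closedBall, dist_eq_norm]
    exact hza.le

/-! ### Nondegeneracy -/

/-- At `a` the curve is at `[u a]`. At `a + 40` its lift has a component of at least `0.98 * 40 ^ 3`
along `v a` and norm at most 104000. -/
theorem half_le_sinDistCP_deform {f : ℂ → CP N} (hf : D.Admissible f) {a : ℂ}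
    (ha : a ∈ D.poles) : 1 / 2 ≤ sinDistCP (D.deform f a) (D.deform f (a + 40)) := by
  have hR := D.large
  have h0 : ‖a - a‖ < R / 2 := by simp; linarith
  have hn : ‖a + 40 - a‖ = 40 := by simp
  have h1 : ‖a + 40 - a‖ < R / 2 := by rw [hn]; linarith
  rw [deform_inner hf ha h0, deform_inner hf ha h1, sinDistCP_mk]
  have e0 : D.innerLift f a a = (8000 : ℂ) • D.u a := by simp [innerLift]
  have hv := le_norm_inner_innerLift hf ha h1
  have hG0 := innerLift_ne_zero hf ha h1
  have hF := norm_normLift_le hf ha (z := a + 40) (by linarith)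
  have hW := norm_err_normLift_le hf ha h1
  have hG : ‖D.innerLift f a (a + 40)‖ ≤ 104000 := by
    unfold innerLift
    refine (norm_add_le _ _).trans ?_
    rw [norm_smul, norm_smul, norm_pow, hn, D.norm_u]
    have h3 := norm_add_le (normLift (D.v a) f (a + 40))
      (D.err a (a + 40) (normLift (D.v a) f (a + 40)))
    have h4 : ‖(8000 : ℂ)‖ = 8000 := by simp
    rw [h4]
    linarith
  rw [hn] at hv
  rw [e0]
  set G := D.innerLift f a (a + 40)
  obtain ⟨c, hc, -⟩ := exists_orthPart_eq ((8000 : ℂ) • D.u a) G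
  have hin : inner ℂ (D.v a) (orthPart ((8000 : ℂ) • D.u a) G) = inner ℂ (D.v a) G := by
    rw [hc, inner_sub_right, inner_smul_right, inner_smul_right, D.inner_v_u]
    simp
  have hle := norm_inner_le_norm (𝕜 := ℂ) (D.v a) (orthPart ((8000 : ℂ) • D.u a) G)
  rw [hin, D.norm_v, one_mul] at hle
  unfold sinDist
  rw [le_div_iff₀ (norm_pos_iff.2 hG0)]
  linarith

theorem exists_speed_deform_ge {f : ℂ → CP N} (hf : D.Admissible f) {a : ℂ}
    (ha : a ∈ D.poles) : ∃ z, ‖z - a‖ ≤ 40 ∧ 1 / 200 ≤ speed (D.deform f) z := by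
  by_contra! h
  have h1 := half_le_sinDistCP_deform hf ha
  have hn : ‖a + 40 - a‖ = 40 := by simp
  have h2 := sinDistCP_le_of_speed_le (isHolomorphicCurve_deform hf) (a := a) (z := a + 40)
    (c := 1 / 200) (fun w hw => (h w (by rwa [hn] at hw)).le)
  rw [hn] at h2
  linarith

theorem isNondegenerate_deform {f : ℂ → CP N} (hf : D.Admissible f)
    (hslow : ∀ a ∈ D.poles, ∀ z, ‖z - a‖ ≤ R → speed f z < 1 / (20 * R))
    (hcover : ∀ z, (∃ a ∈ D.poles, ‖z - a‖ ≤ R) ∨ ∃ w, ‖w - z‖ ≤ R ∧ 1 / (20 * R) ≤ speed f w) :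
    IsNondegenerate (25 * R) (D.deform f) := by
  have hR := D.large
  have hpos := D.pos
  have hs := D.small
  have he := D.eps_nonneg
  intro c
  rcases hcover c with ⟨a, ha, hca⟩ | ⟨w, hw, hsp⟩
  · obtain ⟨z, hz, hz'⟩ := exists_speed_deform_ge hf ha
    refine ⟨z, ?_, le_trans ?_ hz'⟩
    · have := norm_sub_le (z - a) (c - a)
      rw [sub_sub_sub_cancel_right] at this
      linarith
    · exact one_div_le_one_div_of_le (by norm_num) (by linarith)
  · refine ⟨w, by linarith, le_trans ?_ (D.speed_deform_outer hf.holo fun b hb => ?_).2⟩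
    · set ε := C / R ^ 3
      have h1 : (1 - 2 * ε) * (1 / (20 * R)) ≤ (1 - 2 * ε) * speed f w :=
        mul_le_mul_of_nonneg_left hsp (by linarith)
      refine le_trans ?_ (sub_le_sub_right h1 _)
      have h2 : (1 - 2 * ε) * (1 / (20 * R)) - 9 * ε / R = ((1 - 2 * ε) / 20 - 9 * ε) / R := by
        field_simp
      rw [h2, div_le_div_iff₀ (by positivity) hpos]
      nlinarith
    -- A point where `f` is fast lies in no slow disk, so it is far from all poles and the outer
    -- estimate applies.
    · by_contra! hlt
      exact absurd hsp (not_le.2 (hslow b hb w (by linarith)))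

/-! ### The energy over squares -/

theorem abs_sq_sub_sq_le {x y d : ℝ} (hx : 0 ≤ x) (hx' : x ≤ 1) (hy : 0 ≤ y) (hy' : y ≤ 2)
    (h : |x - y| ≤ d) : |x ^ 2 - y ^ 2| ≤ 3 * d := by
  rw [show x ^ 2 - y ^ 2 = (x - y) * (x + y) by ring, abs_mul, abs_of_nonneg (add_nonneg hx hy)]
  nlinarith [abs_nonneg (x - y)]

/-- Three zones: far from the poles the two speeds are close; at distance between `ρ` and `R / 2`
from a pole both are small; on the `ρ`-disks both are at most one and the indicator pays. -/
theorem abs_energy_sub_le {f : ℂ → CP N} (hf : D.Admissible f) (hf1 : ∀ z, speed f z ≤ 1)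
    (hslow : ∀ a ∈ D.poles, ∀ z, ‖z - a‖ ≤ R → speed f z < 1 / (20 * R)) {e ρ : ℝ}
    (hρ : 0 < ρ) (he : 12 * (C / R ^ 3) ≤ e) (he' : 14 / ρ + 6 / R ≤ e) (z : ℂ) :
    |speed f z ^ 2 - speed (D.deform f) z ^ 2| ≤
      e + (⋃ a ∈ D.poles, Metric.ball a ρ).indicator (fun _ => (1 : ℝ)) z := by
  have hR := D.pos
  have hR' := D.large
  have hs := D.small
  have hε := D.eps_nonneg
  have s0 := speed_nonneg f z
  have s1 := hf1 z
  have t0 := speed_nonneg (D.deform f) z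
  have hind : 0 ≤ (⋃ a ∈ D.poles, Metric.ball a ρ).indicator (fun _ => (1 : ℝ)) z :=
    Set.indicator_nonneg (fun _ _ => zero_le_one) z
  rcases D.outer_or_inner z with h | ⟨a, ha, h⟩
  · obtain ⟨h1, h2⟩ := D.speed_deform_outer hf.holo h
    set ε := C / R ^ 3
    have h3 : 9 * ε / R ≤ ε := by rw [div_le_iff₀ hR]; nlinarith
    have h4 : ε * speed f z ≤ ε * 1 := by gcongr
    have h5 : |speed f z - speed (D.deform f) z| ≤ 4 * ε := by
      rw [abs_le]; constructor <;> linarith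
    have := abs_sq_sub_sq_le s0 s1 t0 (by linarith) h5
    linarith
  · have t1 := speed_deform_inner_le_one hf ha h
    rcases lt_or_ge ‖z - a‖ ρ with hlt | hge
    · have hmem : z ∈ ⋃ a ∈ D.poles, Metric.ball a ρ :=
        Set.mem_biUnion ha (by rwa [Metric.mem_ball, dist_eq_norm])
      rw [Set.indicator_of_mem hmem, abs_le]
      constructor <;> nlinarith
    · have t2 := (speed_deform_inner_far hf ha h hρ hge).trans he'
      have s2 : speed f z ≤ e := by
        refine (hslow a ha z (by linarith)).le.trans (le_trans ?_ he')
        have h6 : 1 / (20 * R) ≤ 6 / R := by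
          rw [div_le_div_iff₀ (by positivity) hR]; linarith
        have h7 : 0 < 14 / ρ := by positivity
        linarith
      rw [abs_le]
      constructor <;> nlinarith

/-- The disks of radius `R / 2` about the poles are disjoint, and those about the poles that matter
lie in `Metric.ball c (4 * L)`. Shrinking the radius to `ρ` multiplies areas by `4 ρ² / R²`. -/
theorem volume_iUnion_ball_inter_le (D : PoleConfig N C R) {S : Set ℂ} {c : ℂ} {ρ L : ℝ}
    (hρ : 0 < ρ) (hρL : ρ + R / 2 ≤ 2 * L) (hS : S ⊆ Metric.closedBall c (2 * L)) :
    volume ((⋃ a ∈ D.poles, Metric.ball a ρ) ∩ S) ≤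
      ENNReal.ofReal (4 * ρ ^ 2 / R ^ 2) * volume (Metric.ball c (4 * L)) := by
  have hR := D.pos
  set T : Set ℂ := {b ∈ D.poles | dist b c < 2 * L + ρ} with hT
  have hdisj : T.PairwiseDisjoint fun b => Metric.ball b (R / 2) := fun a ha b hb hab =>
    Metric.ball_disjoint_ball (by linarith [D.separated ha.1 hb.1 hab])
  have hcount : T.Countable := hdisj.countable_of_isOpen (fun _ _ => Metric.isOpen_ball)
    fun b _ => ⟨b, Metric.mem_ball_self (by positivity)⟩
  have hsub : (⋃ a ∈ D.poles, Metric.ball a ρ) ∩ S ⊆ ⋃ b ∈ T, Metric.ball b ρ := by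
    rintro z ⟨hz, hzS⟩
    simp only [Set.mem_iUnion, exists_prop] at hz ⊢
    obtain ⟨a, ha, hza⟩ := hz
    refine ⟨a, ⟨ha, ?_⟩, hza⟩
    have h1 := dist_triangle_left a c z
    have h2 : dist z c ≤ 2 * L := hS hzS
    have h3 : dist z a < ρ := hza
    linarith
  have hball : ∀ b : ℂ, volume (Metric.ball b ρ) =
      ENNReal.ofReal (4 * ρ ^ 2 / R ^ 2) * volume (Metric.ball b (R / 2)) := by
    intro b
    rw [Complex.volume_ball, Complex.volume_ball, ← mul_assoc,
      ← ENNReal.ofReal_pow (by positivity), ← ENNReal.ofReal_pow (by positivity),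
      ← ENNReal.ofReal_mul (by positivity)]
    congr 2
    field_simp
    norm_num
  calc _ ≤ volume (⋃ b ∈ T, Metric.ball b ρ) := measure_mono hsub
    _ ≤ ∑' b : T, volume (Metric.ball (b : ℂ) ρ) := measure_biUnion_le _ hcount _
    _ = ENNReal.ofReal (4 * ρ ^ 2 / R ^ 2) * volume (⋃ b ∈ T, Metric.ball b (R / 2)) := by
        rw [measure_biUnion hcount hdisj fun _ _ => Metric.isOpen_ball.measurableSet,
          ← ENNReal.tsum_mul_left]
        exact tsum_congr fun b => hball b
    _ ≤ _ := by
        gcongr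
        refine Set.iUnion₂_subset fun b hb => Metric.ball_subset_ball' ?_
        linarith [hb.2]

end PoleConfig

theorem isCompact_square (a u : ℂ) (L : ℝ) : IsCompact (square a u L) := by
  have h := (isCompact_Icc (a := (0 : ℝ)) (b := L)).prod (isCompact_Icc (a := (0 : ℝ)) (b := L))
  have hc : Continuous fun p : ℝ × ℝ => a + u * (p.1 + p.2 * Complex.I) := by fun_prop
  convert h.image hc using 1
  ext z
  constructor
  · rintro ⟨x, hx, y, hy, rfl⟩
    exact ⟨(x, y), ⟨hx, hy⟩, rfl⟩
  · rintro ⟨⟨x, y⟩, ⟨hx, hy⟩, rfl⟩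
    exact ⟨x, hx, y, hy, rfl⟩

theorem square_subset_closedBall {a u : ℂ} (hu : ‖u‖ = 1) (L : ℝ) :
    square a u L ⊆ Metric.closedBall a (2 * L) := by
  rintro z ⟨x, hx, y, hy, rfl⟩
  rw [Metric.mem_closedBall, dist_eq_norm, add_sub_cancel_left, norm_mul, hu, one_mul]
  refine (norm_add_le _ _).trans ?_
  rw [norm_mul, Complex.norm_I, mul_one, Complex.norm_real, Complex.norm_real, Real.norm_eq_abs,
    Real.norm_eq_abs, abs_of_nonneg hx.1, abs_of_nonneg hy.1]
  linarith [hx.2, hy.2]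

theorem volume_real_ball_le (c : ℂ) {r : ℝ} (hr : 0 ≤ r) :
    volume.real (Metric.ball c r) ≤ 13 / 4 * r ^ 2 := by
  rw [Measure.real, Complex.volume_ball, ENNReal.toReal_mul, ENNReal.toReal_pow,
    ENNReal.toReal_ofReal hr]
  have h : (((NNReal.pi : NNReal) : ENNReal)).toReal = Real.pi := rfl
  rw [h]
  nlinarith [Real.pi_lt_d2, sq_nonneg r]

namespace PoleConfig

variable {C R : ℝ} {D : PoleConfig N C R}

theorem energy_deform_lt {f : ℂ → CP N} (hf : D.Admissible f) (hf1 : ∀ z, speed f z ≤ 1)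
    (hslow : ∀ a ∈ D.poles, ∀ z, ‖z - a‖ ≤ R → speed f z < 1 / (20 * R)) {e ρ η : ℝ}
    (hρ : 0 < ρ) (he : 12 * (C / R ^ 3) ≤ e) (he' : 14 / ρ + 6 / R ≤ e)
    (hη : 13 * e + 208 * (ρ ^ 2 / R ^ 2) < η) (hρR : ρ ≤ R) {a u : ℂ} {L : ℝ} (hu : ‖u‖ = 1)
    (hL : R ≤ L) :
    |(∫ z in square a u L, speed f z ^ 2) - ∫ z in square a u L, speed (D.deform f) z ^ 2| <
      η * L ^ 2 := by
  have hR := D.pos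
  have hS := isCompact_square a u L
  have hsub := square_subset_closedBall (a := a) hu L
  have hL0 : 0 < L := by linarith
  have he0 : 0 ≤ e := le_trans (by positivity) he'
  set S := square a u L
  set B := ⋃ a ∈ D.poles, Metric.ball a ρ with hB
  have hBm : MeasurableSet B :=
    (isOpen_biUnion fun _ _ => Metric.isOpen_ball).measurableSet
  have hi1 : IntegrableOn (fun z => speed f z ^ 2) S :=
    ((continuous_speed hf.holo).pow 2).continuousOn.integrableOn_compact hS
  have hi2 : IntegrableOn (fun z => speed (D.deform f) z ^ 2) S :=
    ((continuous_speed (isHolomorphicCurve_deform hf)).pow 2).continuousOn.integrableOn_compact hS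
  have hic : IntegrableOn (fun _ : ℂ => e) S := integrableOn_const hS.measure_lt_top.ne
  have hib : IntegrableOn (B.indicator fun _ => (1 : ℝ)) S :=
    (integrableOn_const hS.measure_lt_top.ne).indicator hBm
  have hball : volume.real (Metric.ball a (4 * L)) ≤ 52 * L ^ 2 :=
    (volume_real_ball_le a (by positivity)).trans (le_of_eq (by ring))
  have hvS : volume.real S ≤ 13 * L ^ 2 := by
    have h1 : volume.real S ≤ volume.real (Metric.closedBall a (2 * L)) :=
      measureReal_mono hsub (isCompact_closedBall a (2 * L)).measure_lt_top.ne
    have h2 : volume.real (Metric.closedBall a (2 * L)) = volume.real (Metric.ball a (2 * L)) := by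
      rw [Measure.real, Measure.real, Measure.addHaar_closedBall_eq_addHaar_ball]
    rw [h2] at h1
    exact h1.trans ((volume_real_ball_le a (by positivity)).trans (le_of_eq (by ring)))
  have hvB : volume.real (B ∩ S) ≤ 208 * (ρ ^ 2 / R ^ 2) * L ^ 2 := by
    have h1 := ENNReal.toReal_mono (by finiteness)
      (D.volume_iUnion_ball_inter_le hρ (by linarith : ρ + R / 2 ≤ 2 * L) hsub)
    rw [ENNReal.toReal_mul, ENNReal.toReal_ofReal (by positivity)] at h1
    calc _ ≤ 4 * ρ ^ 2 / R ^ 2 * (52 * L ^ 2) := h1.trans (by gcongr; exact hball)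
      _ = _ := by ring
  calc _ = |∫ z in S, (speed f z ^ 2 - speed (D.deform f) z ^ 2)| := by rw [integral_sub hi1 hi2]
    _ ≤ ∫ z in S, |speed f z ^ 2 - speed (D.deform f) z ^ 2| := abs_integral_le_integral_abs
    _ ≤ ∫ z in S, (e + B.indicator (fun _ => (1 : ℝ)) z) :=
        setIntegral_mono (hi1.sub hi2).abs (hic.add hib) fun z =>
          abs_energy_sub_le hf hf1 hslow hρ he he' z
    _ = e * volume.real S + volume.real (B ∩ S) := by
        rw [integral_add hic hib, setIntegral_const, smul_eq_mul, mul_comm,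
          integral_indicator_const _ hBm, measureReal_restrict_apply hBm, smul_eq_mul, mul_one]
    _ ≤ e * (13 * L ^ 2) + 208 * (ρ ^ 2 / R ^ 2) * L ^ 2 := by gcongr
    _ = (13 * e + 208 * (ρ ^ 2 / R ^ 2)) * L ^ 2 := by ring
    _ < _ := by gcongr

end PoleConfig

/-! ### The pole configuration of a Brody curve -/

theorem exists_unit_orthogonal (hN : 1 ≤ N) (v : HomCoord N) :
    ∃ u : HomCoord N, ‖u‖ = 1 ∧ inner ℂ v u = 0 := by
  have hne : (ℂ ∙ v)ᗮ ≠ ⊥ := by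
    intro h
    rw [Submodule.orthogonal_eq_bot_iff] at h
    have h1 := finrank_span_le_card (R := ℂ) ({v} : Set (HomCoord N))
    rw [h, finrank_top] at h1
    simp at h1
    omega
  obtain ⟨x, hx, hx0⟩ := Submodule.exists_mem_ne_zero_of_ne_bot hne
  have hx' : ‖x‖ ≠ 0 := norm_ne_zero_iff.2 hx0
  refine ⟨((‖x‖ : ℂ)⁻¹) • x, ?_, ?_⟩
  · rw [norm_smul, norm_inv, Complex.norm_real, norm_norm, inv_mul_cancel₀ hx']
  · rw [inner_smul_right, Submodule.mem_orthogonal_singleton_iff_inner_right.1 hx, mul_zero]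

theorem exists_poleConfig (hN : 1 ≤ N) {C R : ℝ} (hC : IsSumBound C) (hR : 100 ≤ R)
    (hs : C / R ^ 3 ≤ 1 / 100000) {f : ℂ → CP N} (hf : f ∈ BrodyCurves N) :
    ∃ D : PoleConfig N C R, (∀ g ∈ brodyBall (1 / 20) f, D.Admissible g) ∧
      (∀ a ∈ D.poles, ∀ z, ‖z - a‖ ≤ R → speed f z < 1 / (20 * R)) ∧
      ∀ z, (∃ a ∈ D.poles, ‖z - a‖ ≤ R) ∨ ∃ w, ‖w - z‖ ≤ R ∧ 1 / (20 * R) ≤ speed f w := by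
  have hpos : 0 < R := by linarith
  obtain ⟨Λ, hΛ, hsep, hmax⟩ := exists_maximal_separated
    {a : ℂ | ∀ z, ‖z - a‖ ≤ R → speed f z < 1 / (20 * R)} R
  have hrep : ∀ a, ‖(f a).rep‖ ≠ 0 := fun a => norm_ne_zero_iff.2 (f a).rep_nonzero
  choose u hu hvu using fun a => exists_unit_orthogonal hN ((‖(f a).rep‖ : ℂ)⁻¹ • (f a).rep)
  refine ⟨⟨u, fun a => (‖(f a).rep‖ : ℂ)⁻¹ • (f a).rep, Λ, hu, fun a => ?_, hvu, hsep, hC, hR,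
    hs⟩, fun g hg => ⟨hg.1.1, fun a ha z hz => ?_⟩, fun a ha => hΛ ha, fun z => ?_⟩
  · rw [norm_smul, norm_inv, Complex.norm_real, norm_norm, inv_mul_cancel₀ (hrep a)]
  · change sinDist ((‖(f a).rep‖ : ℂ)⁻¹ • (f a).rep) (g z).rep ≤ 1 / 5
    have h0 : (‖(f a).rep‖ : ℂ)⁻¹ ≠ 0 := inv_ne_zero (by exact_mod_cast hrep a)
    have h1 := sinDist_smul (f a).rep (g z).rep h0 one_ne_zero
    rw [one_smul] at h1
    rw [h1]
    change sinDistCP (f a) (g z) ≤ 1 / 5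
    have h2 := sinDistCP_triangle (f a) (f z) (g z)
    -- The admissibility bound `1/5` splits into a drift of `f` of at most `1/10` over the slow disk
    -- and twice the ball radius `1/20`.
    have h3 := sinDistCP_le_of_speed_le hf.1 (a := a) (z := z) (c := 1 / (20 * R))
      (fun w hw => (hΛ ha w (hw.trans hz)).le)
    have h4 : 2 * (1 / (20 * R)) * ‖z - a‖ ≤ 2 * (1 / (20 * R)) * R := by gcongr
    have h5 : 2 * (1 / (20 * R)) * R = 1 / 10 := by field_simp; norm_num
    have h6 := sinDistCP_le_dFS (f z) (g z)
    have h7 := (dFS_le_dC f g z).trans hg.2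
    linarith
  · by_cases hz : ∀ w, ‖w - z‖ ≤ R → speed f w < 1 / (20 * R)
    · left
      rcases hmax z hz with h | ⟨a, ha, h⟩
      · exact ⟨z, h, by simpa using hpos.le⟩
      · exact ⟨a, ha, by rw [← dist_eq_norm]; exact h.le⟩
    · right
      push Not at hz
      exact hz

/-- The scale at which a given accuracy is achieved. -/
theorem exists_scale {C : ℝ} (hC : 0 < C) {η : ℝ} (hη : 0 < η) (hη1 : η ≤ 1) :
    ∃ R ρ e : ℝ, 100 ≤ R ∧ C / R ^ 3 ≤ 1 / 100000 ∧ 0 < ρ ∧ 12 * (C / R ^ 3) ≤ e ∧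
      14 / ρ + 6 / R ≤ e ∧ 13 * e + 208 * (ρ ^ 2 / R ^ 2) < η ∧ ρ ≤ R ∧ 4 * (C / R ^ 3) ≤ η := by
  set R : ℝ := (C + 1) * 1000000 / η ^ 2 with hR
  have hη2 : η ^ 2 ≤ η := by nlinarith
  have hRη : R * η ^ 2 = (C + 1) * 1000000 := by rw [hR]; field_simp
  have hR1 : 1000000 ≤ R := by
    rw [hR, le_div_iff₀ (by positivity)]
    nlinarith
  have hRη' : (C + 1) * 1000000 ≤ R * η := by rw [← hRη]; gcongr
  have hε : C / R ^ 3 ≤ η / 1000000 := by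
    rw [div_le_iff₀ (by positivity)]
    have h2 : 1 ≤ R ^ 2 := by nlinarith
    have h3 : R * η * 1 ≤ R * η * R ^ 2 := by gcongr
    nlinarith
  have hρR : 1400 / η ≤ R * (η / 700) := by
    rw [div_le_iff₀ hη, show R * (η / 700) * η = R * η ^ 2 / 700 by ring, hRη]
    linarith
  refine ⟨R, 1400 / η, η / 50, by linarith, by linarith, by positivity, by linarith, ?_, ?_, ?_,
    by linarith⟩
  · have h1 : 14 / (1400 / η) = η / 100 := by field_simp; norm_num
    have h2 : 6 / R ≤ η / 100 := by
      rw [div_le_iff₀ (by linarith)]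
      nlinarith
    linarith
  · have h1 : (1400 / η) ^ 2 / R ^ 2 ≤ (η / 700) ^ 2 := by
      rw [div_le_iff₀ (by positivity), ← mul_pow]
      gcongr
      linarith
    have h2 : 208 * (η / 700) ^ 2 ≤ η / 2 := by nlinarith
    linarith
  · nlinarith

end Brody

theorem mainTheorem8 (N : ℕ) (hN : 1 ≤ N) :
    ∃ (δ₂ : ℝ) (hδ₂ : 0 < δ₂) (C₃ : ℝ), 1 < C₃ ∧
      ∀ η : ℝ, 0 < η → ∃ R₁ : ℝ, 0 < R₁ ∧
        ∀ (f : ℂ → Brody.CP N) (hf : f ∈ Brody.BrodyCurves N),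
          ∃ Φ : Brody.brodyBall δ₂ f → Brody.LipCurves N (1 + η),
            -- `Φ(f)` is nondegenerate
            Brody.IsNondegenerate R₁
              (Φ ⟨f, Brody.mem_brodyBall_self hδ₂ hf⟩ : ℂ → Brody.CP N) ∧
            -- control of distances
            (∀ (g₁ g₂ : Brody.brodyBall δ₂ f) (z : ℂ),
              Brody.dFS ((Φ g₁ : ℂ → Brody.CP N) z) ((Φ g₂ : ℂ → Brody.CP N) z) ≤
                  C₃ * Brody.dFS ((g₁ : ℂ → Brody.CP N) z) ((g₂ : ℂ → Brody.CP N) z) ∧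
                Brody.dFS ((g₁ : ℂ → Brody.CP N) z) ((g₂ : ℂ → Brody.CP N) z) ≤
                  C₃ * ⨆ w : Metric.closedBall z 3,
                    Brody.dFS ((Φ g₁ : ℂ → Brody.CP N) w) ((Φ g₂ : ℂ → Brody.CP N) w)) ∧
            (∀ g : Brody.brodyBall δ₂ f,
              Brody.dC (Φ ⟨f, Brody.mem_brodyBall_self hδ₂ hf⟩ : ℂ → Brody.CP N)
                (Φ g : ℂ → Brody.CP N) ≤ C₃ * δ₂) ∧
            -- control of energies over squares
            (∀ (a u : ℂ) (L : ℝ), ‖u‖ = 1 → R₁ ≤ L →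
              |(∫ z in Brody.square a u L, Brody.speed f z ^ 2) -
                  ∫ z in Brody.square a u L,
                    Brody.speed (Φ ⟨f, Brody.mem_brodyBall_self hδ₂ hf⟩ : ℂ → Brody.CP N) z ^ 2| <
                η * L ^ 2) := by
  obtain ⟨C, hC⟩ := Brody.exists_isSumBound
  -- `C₃` is twice the constant 600000000 of `exists_sinDistCP_le_deform`, the 2 converting sines to
  -- distances. Neither constant involves `η`, which enters only through the scale `R`.
  refine ⟨1 / 20, by norm_num, 1200000000, by norm_num, fun η hη => ?_⟩
  -- The scale is chosen for `min η 1`, as `exists_scale` assumes accuracy at most one.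
  obtain ⟨R, ρ, e, hR, hs, hρ, he, he', hηe, hρR, hεη⟩ := Brody.exists_scale hC.1
    (lt_min hη one_pos) (min_le_right η 1)
  have hmin := min_le_left η 1
  refine ⟨25 * R, by linarith, fun f hf => ?_⟩
  obtain ⟨D, hadm, hslow, hcover⟩ := Brody.exists_poleConfig hN hC hR hs hf
  have hself := hadm f (Brody.mem_brodyBall_self (by norm_num) hf)
  have hspeed : ∀ g ∈ Brody.brodyBall (1 / 20) f, ∀ z,
      Brody.speed (D.deform g) z ≤ 1 + η := by
    intro g hg z
    rcases D.outer_or_inner z with h | ⟨a, ha, h⟩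
    · have h1 := (D.speed_deform_outer (hadm g hg).holo h).1
      have h2 := D.eps_nonneg
      have h3 := mul_le_mul_of_nonneg_left (hg.1.2 z)
        (by linarith : 0 ≤ 1 + 3 * (C / R ^ 3))
      linarith
    · linarith [Brody.PoleConfig.speed_deform_inner_le_one (hadm g hg) ha h]
  have hdist : ∀ g₁ ∈ Brody.brodyBall (1 / 20) f, ∀ g₂ ∈ Brody.brodyBall (1 / 20) f, ∀ z,
      Brody.dFS (D.deform g₁ z) (D.deform g₂ z) ≤ 1200000000 * Brody.dFS (g₁ z) (g₂ z) := by
    intro g₁ hg₁ g₂ hg₂ z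
    have h1 := Brody.PoleConfig.sinDistCP_deform_le (hadm g₁ hg₁) (hadm g₂ hg₂) z
    have h2 := Brody.dFS_le_sinDistCP (D.deform g₁ z) (D.deform g₂ z)
    have h3 := Brody.sinDistCP_le_dFS (g₁ z) (g₂ z)
    have h4 := Brody.dFS_nonneg (g₁ z) (g₂ z)
    linarith
  refine ⟨fun g => ⟨D.deform g, Brody.PoleConfig.isHolomorphicCurve_deform (hadm g g.2),
    hspeed g g.2⟩, Brody.PoleConfig.isNondegenerate_deform hself hslow hcover,
    fun g₁ g₂ z => ⟨hdist g₁ g₁.2 g₂ g₂.2 z, ?_⟩, fun g => ?_, fun a u L hu hL => ?_⟩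
  · have h1 := Brody.PoleConfig.exists_sinDistCP_le_deform (hadm g₁ g₁.2) (hadm g₂ g₂.2) z
      (s := 2 * ⨆ w : Metric.closedBall z 3,
        Brody.dFS (D.deform (g₁ : ℂ → Brody.CP N) w) (D.deform (g₂ : ℂ → Brody.CP N) w))
      (fun w hw => by
        have hw' : w ∈ Metric.closedBall z 3 := by rwa [Metric.mem_closedBall, dist_eq_norm]
        refine (Brody.sinDistCP_le_dFS _ _).trans (mul_le_mul_of_nonneg_left ?_ (by norm_num))
        exact le_ciSup (f := fun w : Metric.closedBall z 3 =>
          Brody.dFS (D.deform (g₁ : ℂ → Brody.CP N) w) (D.deform (g₂ : ℂ → Brody.CP N) w))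
          (Brody.bddAbove_dFS _ _) ⟨w, hw'⟩)
    refine (Brody.dFS_le_sinDistCP _ _).trans (h1.trans (le_of_eq ?_))
    ring
  · refine ciSup_le fun z => (hdist f (Brody.mem_brodyBall_self (by norm_num) hf) g g.2 z).trans ?_
    exact mul_le_mul_of_nonneg_left ((Brody.dFS_le_dC f g z).trans g.2.2) (by norm_num)
  · refine (Brody.PoleConfig.energy_deform_lt hself hf.2 hslow hρ he he' hηe hρR hu
      (by linarith)).trans_le ?_
    gcongr
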